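/- **Conventions.** Let $(A,\sigma)$ be a perfect inversive difference field ($\sigma$ is an automorphism) and $V$ a finite set. A variety over $A$ is the solution set, in difference field extensions of $A$, of finitely many difference equations over $A$ in finitely many variables. Its total dimension $\dim X$ is the largest transcendence degree over $A$ of a difference field $A(x)_\sigma$ generated by a point $x$ of $X$. A projection $X\to Y$ (restriction to some of the coordinates) is dominant if every generic point of a top-dimensional component of $Y$ is, up to isomorphism over $A$, the image of a generic point of a top-dimensional component of $X$; it is finite if every point of $X$ is algebraic over the difference field generated over $A$ by its image. Write $P(u)^-$ for the set of proper subsets of $u$. A *system of varieties* $\Omega$ on $V$ over $A$ assigns to each $u\subseteq V$ a variety $\Omega(u)$ over $A$ of finite total dimension (positive if $u\ne\emptyset$; $\Omega(\emptyset)$ is a point) and, functorially, to each $v\subseteq u$ a dominant projection $\Omega(u)\to\Omega(v)$, such that for $|u|\ge 2$, writing $\Omega(u)^-$ for the fibre product of the $\Omega(v)$, $v\in P(u)^-$: (1) there is a finite family $\mathcal P_u$ of one-variable polynomials whose coefficients are difference polynomials over $A$ in the coordinates of $\Omega(u)^-$ such that for each point $x\in\Omega(u)$ with image $a\in\Omega(u)^-$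 the field $A(x)_\sigma$ is the splitting field of $\mathcal P_u$ (specialised at $a$) over $A(a)_\sigma$; (2) the projection $\rho_u:\Omega(u)\to\Omega(u)^-$ is dominant. Put $\phi_u=\rho_u\Omega(u)$. The *degrees* of $\Omega$ are the numbers of variables, the numbers, orders and degrees of the defining equations of the $\Omega(u)$, and the largest numbers of points in a fibre of the covers $\Omega(u)\to\Omega(u)^-$, $|u|\ge2$. A *$P(u)^-$-refinement* of $\Omega\upharpoonright P(u)^-$ over a perfect inversive difference field $A'\supseteq A$ is a system $\Omega'$ on $u$ over $A'$ with $\Omega'(u)$ the fibre product of the $\Omega'(v)$, $v\in P(u)^-$, together with finite dominant projections $\Omega'(v)\to\Omega(v)$ ($v\in P(u)^-$) and $\pi:\Omega'(u)\to\Omega(u)^-$ that commute with the projections of the systems. For a prime power $q=p^n$, $K_q$ is the algebraic closure of $\mathbb F_p$ with the operator $x\mapsto x^q$. A property of data over $A$ holds *for almost all $q$* if there is a finitely generated difference subring $R\subseteq A$ over which the data are defined such that, for all sufficiently large prime powers $q$ and all difference ring homomorphisms $h:R\to K_q$, it holds in $K_q$ of the data obtained by applying $h$ to the parameters. A *$P(u)^-$-chain*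 $W$ in (a specialisation of) $\Omega'$ consists of sets $W(v)\subseteq\Omega'(v)$, $v\in P(u)^-$, such that $W(v)$ contains the projection of $W(v')$ whenever $v\subseteq v'$; $W(u)$ denotes their fibre product. Let $\epsilon=(\epsilon_u)_{u\subseteq V,\,|u|\ge2}$ with $\epsilon_u:\mathbb N\to[0,\infty)$. * $\Omega$ is *$\epsilon$-étale-edge-uniform with constant $C$* if for all $u\subseteq V$ with $|u|\ge 2$ and all $P(u)^-$-refinements $\Omega'$ of $\Omega\upharpoonright P(u)^-$ over a finitely generated algebraic extension $A'$ of $A$, for almost all $q$, every $P(u)^-$-chain $W$ in $\Omega'$ satisfies (specialising to $K_q$, and if $\phi_u\neq\emptyset$) $$\left|\frac{|\phi_u\cap\pi(W(u))|}{|\phi_u|}-\frac{|\pi(W(u))|}{|\Omega(u)^-|}\right|\le C\,\epsilon_u(q).$$ * $\Omega$ is *$\epsilon$-quasirandom with constant $C$* if for almost all $q$ and all $u\subseteq V$ with $|u|\ge2$, specialising to $K_q$, the sets below are finite and, with $f_u=\mathbb 1_{\phi_u}-\frac{|\phi_u|}{|\Omega(u)^-|}\mathbb 1_{\Omega(u)^-}$,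 $$\Bigl|\sum_{z\in D}\ \prod_{\iota\in\{0,1\}^u}f_u(z_\iota)\Bigr|\le C\,\epsilon_u(q)\,|\Omega(u)^-|^2 .$$ Here $D=D(\Omega\upharpoonright P(u)^-)$ is the doubling: the fibre product of copies $\Omega(v,\kappa)$ of $\Omega(v)$ for $v\in P(u)^-$, $\kappa\in\{0,1\}^v$, along the projections $\Omega(v',\kappa)\to\Omega(v,\kappa\upharpoonright v)$ for $v\subseteq v'$; and $z_\iota\in\Omega(u)^-$ is the family of the components of $z$ in the $\Omega(v,\iota\upharpoonright v)$, $v\in P(u)^-$. **Proposition.** For every system of varieties $\Omega$ on $V$ over $A$ and every $\epsilon$ as above, if $\Omega$ is $\epsilon$-étale-edge-uniform then $\Omega$ is $\epsilon$-quasirandom. More precisely, for every finite set $V$ and all $D,C$ there is a constant $C'$, depending only on $V$, $D$ and $C$, such that for all $A$, $\Omega$ and $\epsilon$: if $D$ is the least bound for the degrees of $\Omega$ and $\Omega$ is $\epsilon$-étale-edge-uniform with constant $C$, then $\Omega$ is $\epsilon$-quasirandom with constant $C'$. -/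

import Mathlib

open scoped NNReal

universe u w

noncomputable section

namespace DiffHyper

/-! ## Difference fields, difference varieties and their points -/

/-- A difference field extension `K` of the inversive difference field `(A, σ)`: a field extension
with an endomorphism `τ` that extends `σ`. -/
structure DiffExt (A : Type u) [Field A] (σ : A ≃+* A) where
  K : Type u
  [field : Field K]
  [algebra : Algebra A K]
  τ : K →+* K
  comm : ∀ a : A, τ (algebraMap A K a) = algebraMap A K (σ a)

attribute [instance] DiffExt.field DiffExt.algebra

/-- The family of all `τ ^ n (x i)`. Difference polynomials over `A` in the variables `ι` are the
elements of `MvPolynomial (ι × ℕ) A`, the variable `(i, n)` standing for `σ ^ n (x i)`; the value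
of such a polynomial at `x` is its ordinary value at `jet τ x`. -/
def jet {K : Type*} {ι : Type*} (τ : K → K) (x : ι → K) : ι × ℕ → K :=
  fun m => τ^[m.2] (x m.1)

section Points

variable {A : Type u} [Field A] {σ : A ≃+* A}

/-- The difference field `A(x)_σ` generated over `A` by the tuple `x`. -/
def diffAdjoin (L : DiffExt A σ) {ι : Type*} (x : ι → L.K) : IntermediateField A L.K :=
  IntermediateField.adjoin A (Set.range (jet L.τ x))

/-- The transcendence degree of `A(x)_σ` over `A`. -/
def trdegAt (L : DiffExt A σ) {ι : Type*} (x : ι → L.K) : ℕ∞ :=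
  Cardinal.toENat (Algebra.trdeg A (diffAdjoin L x))

/-- The ideal of the difference polynomials over `A` that vanish at `x`. Two tuples are generic
points of the same irreducible difference variety over `A` iff they have the same ideal. -/
def vanishingIdeal (L : DiffExt A σ) {ι : Type*} (x : ι → L.K) :
    Ideal (MvPolynomial (ι × ℕ) A) :=
  RingHom.ker (MvPolynomial.aeval (jet L.τ x) : MvPolynomial (ι × ℕ) A →ₐ[A] L.K)

variable (σ) in
/-- A set of points in affine `ι`-space over every difference field extension of `A`. It is used
for difference varieties and for fibre products of difference varieties. -/
abbrev PointSet (ι : Type*) := ∀ L : DiffExt A σ, Set (ι → L.K)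

/-- Total dimension over `A`: the largest transcendence degree of `A(x)_σ` at a point `x`, which is
the largest transcendence degree of the difference function field of a component
(`⊤` if there is no largest one). -/
def totalDim {ι : Type*} (X : PointSet σ ι) : ℕ∞ :=
  ⨆ (L : DiffExt A σ) (x : ι → L.K) (_ : x ∈ X L), trdegAt L x

/-- The coordinate projection `x ↦ x ∘ f` from `X` to `Y` is dominant: over each top-dimensional
component of `Y` there is a top-dimensional component of `X` whose generic point is mapped to
a generic point of the former. (In finite total dimension the points at which the transcendence
degree is the total dimension are exactly the generic points of top-dimensional components.) -/
def Dominant {ι κ : Type*} (f : ι → κ) (X : PointSet σ κ) (Y : PointSet σ ι) : Prop :=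
  ∀ (L : DiffExt A σ), ∀ y ∈ Y L, trdegAt L y = totalDim Y →
    ∃ L' : DiffExt A σ, ∃ x ∈ X L', trdegAt L' x = totalDim X ∧
      vanishingIdeal L' (x ∘ f) = vanishingIdeal L y

/-- The coordinate projection `x ↦ x ∘ f` maps `X` to `Y`. -/
def Projects {ι κ : Type*} (f : ι → κ) (X : PointSet σ κ) (Y : PointSet σ ι) : Prop :=
  ∀ (L : DiffExt A σ), ∀ x ∈ X L, x ∘ f ∈ Y L

/-- The coordinate projection `x ↦ x ∘ f` from `X` is finite: every point is algebraic over the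
difference field generated by its image. -/
def FiniteProj {ι κ : Type*} (f : ι → κ) (X : PointSet σ κ) : Prop :=
  ∀ (L : DiffExt A σ), ∀ x ∈ X L, ∀ i, IsAlgebraic (diffAdjoin L (x ∘ f)) (x i)

end Points

/-! ## Diagrams of difference varieties indexed by finite sets -/

/-- A family of difference varieties over `A` (finite sets of difference equations in finitely many
coordinates), indexed by the finite subsets of `V`, with maps between the sets of coordinates. The
laws are imposed in `IsSystem`, on a given collection of subsets; what the data are on the other
subsets is irrelevant. -/
structure VarDiagram (A : Type u) [Field A] (V : Type w) where
  coord : Finset V → Type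
  [fintypeCoord : ∀ v, Fintype (coord v)]
  eqs : ∀ v, Set (MvPolynomial (coord v × ℕ) A)
  eqs_finite : ∀ v, (eqs v).Finite
  emb : ∀ {v v' : Finset V}, v ⊆ v' → coord v → coord v'

attribute [instance] VarDiagram.fintypeCoord

namespace VarDiagram

variable {A : Type u} [Field A] {V : Type w}

/-- The same equations, over a larger field. -/
def baseChange (Ω : VarDiagram A V) (B : Type u) [Field B] [Algebra A B] : VarDiagram B V where
  coord := Ω.coord
  eqs v := MvPolynomial.map (algebraMap A B) '' Ω.eqs v
  eqs_finite v := (Ω.eqs_finite v).image _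
  emb := Ω.emb

/-- The points of the difference variety `Ω(v)`. -/
def pts (Ω : VarDiagram A V) (σ : A ≃+* A) (v : Finset V) : PointSet σ (Ω.coord v) :=
  fun L => {x | ∀ p ∈ Ω.eqs v, MvPolynomial.aeval (jet L.τ x) p = 0}

/-- The coordinates of the fibre product `Ω(u)⁻` of the `Ω(v)`, `v ⊊ u`. -/
abbrev BdCoord (Ω : VarDiagram A V) (u : Finset V) : Type w :=
  Σ v : {v : Finset V // v ⊂ u}, Ω.coord v.1

/-- The coordinate map of the projection `ρ_u : Ω(u) → Ω(u)⁻`, `x ↦ x ∘ bdEmb u`. -/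
def bdEmb (Ω : VarDiagram A V) (u : Finset V) : Ω.BdCoord u → Ω.coord u :=
  fun j => Ω.emb j.1.2.subset j.2

section Sets

variable {k : Type*} (Ω : VarDiagram A V)

/-- The component in `v ⊊ u` of a point of affine space with coordinates `Ω.BdCoord u`. -/
def bdRes {u : Finset V} (a : Ω.BdCoord u → k) (v : Finset V) (hv : v ⊂ u) : Ω.coord v → k :=
  fun i => a ⟨⟨v, hv⟩, i⟩

/-- The fibre product of the sets `S v`, `v ⊊ u`: the compatible families of points. -/
def fibreProd (S : ∀ v, Set (Ω.coord v → k)) (u : Finset V) : Set (Ω.BdCoord u → k) :=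
  {a | (∀ v (hv : v ⊂ u), Ω.bdRes a v hv ∈ S v) ∧
    ∀ v v' (h : v ⊆ v') (hv' : v' ⊂ u),
      Ω.bdRes a v' hv' ∘ Ω.emb h = Ω.bdRes a v (h.trans_ssubset hv')}

/-- `φ_u = ρ_u S(u)`. -/
def phi (S : ∀ v, Set (Ω.coord v → k)) (u : Finset V) : Set (Ω.BdCoord u → k) :=
  (fun x => x ∘ Ω.bdEmb u) '' S u

/-- The function `f_u = 1_{φ_u} - (|φ_u| / |S(u)⁻|) 1_{S(u)⁻}`. -/
def balanced (S : ∀ v, Set (Ω.coord v → k)) (u : Finset V) : (Ω.BdCoord u → k) → ℝ :=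
  fun y => (Ω.phi S u).indicator 1 y -
    ((Ω.phi S u).ncard : ℝ) / ((Ω.fibreProd S u).ncard : ℝ) * (Ω.fibreProd S u).indicator 1 y

/-- The doubling of the restriction of `S` to the proper subsets of `u`: the fibre product of
copies `S(v, κ)` of `S(v)`, for `v ⊊ u` and `κ : v → {0, 1}`, along the projections
`S(v', κ) → S(v, κ|v)` for `v ⊆ v'`. -/
def doubling (S : ∀ v, Set (Ω.coord v → k)) (u : Finset V) :
    Set (∀ v : {v : Finset V // v ⊂ u}, (v.1 → Bool) → Ω.coord v.1 → k) :=
  {z | (∀ v κ, z v κ ∈ S v.1) ∧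
    ∀ (v v' : {v : Finset V // v ⊂ u}) (h : v.1 ⊆ v'.1) (κ : v'.1 → Bool),
      z v' κ ∘ Ω.emb h = z v (fun i => κ ⟨i.1, h i.2⟩)}

/-- The projection of a point of the doubling to the copy of `S(u)⁻` given by `κ : u → {0, 1}`. -/
def vertex {u : Finset V} (z : ∀ v : {v : Finset V // v ⊂ u}, (v.1 → Bool) → Ω.coord v.1 → k)
    (κ : u → Bool) : Ω.BdCoord u → k :=
  fun j => z j.1 (fun i => κ ⟨i.1, j.1.2.subset i.2⟩) j.2

/-- `W` is a `P(u)⁻`-chain in `S`. The sets `W v`, `v ⊊ u`, are given, and the set at `u` is their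
fibre product `Ω.fibreProd W u`. -/
def IsChain (S W : ∀ v, Set (Ω.coord v → k)) (u : Finset V) : Prop :=
  (∀ v, v ⊂ u → W v ⊆ S v) ∧
    ∀ v v' (h : v ⊆ v'), v' ⊂ u → ∀ x ∈ W v', x ∘ Ω.emb h ∈ W v

end Sets

/-! ## Systems of difference varieties -/

section Systems

variable (Ω : VarDiagram A V) (σ : A ≃+* A)

/-- The points of the fibre product `Ω(u)⁻`. -/
def bdPts (u : Finset V) : PointSet σ (Ω.BdCoord u) :=
  fun L => Ω.fibreProd (fun v => Ω.pts σ v L) u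

/-- There is a finite family `P` of polynomials in one variable over the difference polynomials in
the coordinates of `Ω(u)⁻` such that, for each point `x` of `Ω(u)` with image `a` in `Ω(u)⁻`, the
field `A(x)_σ` is the splitting field over `A(a)_σ` of the family `P` specialised at `a`. -/
def IsSplittingCover (u : Finset V) : Prop :=
  ∃ P : Set (Polynomial (MvPolynomial (Ω.BdCoord u × ℕ) A)), P.Finite ∧
    ∀ (L : DiffExt A σ), ∀ x ∈ Ω.pts σ u L,
      let ev : MvPolynomial (Ω.BdCoord u × ℕ) A →+* L.K :=
        (MvPolynomial.aeval (jet L.τ (x ∘ Ω.bdEmb u)) :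
          MvPolynomial (Ω.BdCoord u × ℕ) A →ₐ[A] L.K)
      (∀ f ∈ P, (f.map ev).Splits) ∧
      diffAdjoin L x = IntermediateField.adjoin A
        (Set.range (jet L.τ (x ∘ Ω.bdEmb u)) ∪ {r | ∃ f ∈ P, r ∈ (f.map ev).roots})

/-- The part of `Ω` indexed by `J` is a system of difference varieties over `(A, σ)`. -/
structure IsSystem (J : LowerSet (Finset V)) : Prop where
  emb_injective : ∀ {v v'} (h : v ⊆ v'), v' ∈ J → Function.Injective (Ω.emb h)
  emb_refl : ∀ {v}, v ∈ J → ∀ i, Ω.emb (Finset.Subset.refl v) i = i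
  emb_trans : ∀ {v v' v''} (h : v ⊆ v') (h' : v' ⊆ v''), v'' ∈ J →
    ∀ i, Ω.emb (h.trans h') i = Ω.emb h' (Ω.emb h i)
  /-- `Ω(∅)` is the point. -/
  empty_coord : IsEmpty (Ω.coord ∅)
  empty_pts : ∀ (L : DiffExt A σ) (x : Ω.coord ∅ → L.K), x ∈ Ω.pts σ ∅ L
  dim_lt_top : ∀ v ∈ J, totalDim (Ω.pts σ v) < ⊤
  dim_pos : ∀ v ∈ J, v.Nonempty → 0 < totalDim (Ω.pts σ v)
  projects : ∀ {v v'} (h : v ⊆ v'), v' ∈ J → Projects (Ω.emb h) (Ω.pts σ v') (Ω.pts σ v)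
  dominant : ∀ {v v'} (h : v ⊆ v'), v' ∈ J → Dominant (Ω.emb h) (Ω.pts σ v') (Ω.pts σ v)
  splitting : ∀ v ∈ J, 2 ≤ v.card → Ω.IsSplittingCover σ v
  dominant_bd : ∀ v ∈ J, 2 ≤ v.card → Dominant (Ω.bdEmb v) (Ω.pts σ v) (Ω.bdPts σ v)

/-- The map of coordinates of the fibre products induced by maps of coordinates. -/
def bdMap {Ω Ω' : VarDiagram A V} (j : ∀ v, Ω.coord v → Ω'.coord v) (u : Finset V) :
    Ω.BdCoord u → Ω'.BdCoord u :=
  fun i => ⟨i.1, j i.1.1 i.2⟩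

/-- With the fibre product `Ω'(u)⁻` as its value at `u`, `Ω'` is a system of difference varieties on
`u` which is a `P(u)⁻`-refinement of the restriction of `Ω` to `P(u)⁻` (whose value at `u` is
`Ω(u)⁻`). The projections `Ω'(v) → Ω(v)` are `x ↦ x ∘ j v`. -/
structure IsBdRefinement (Ω Ω' : VarDiagram A V) (j : ∀ v, Ω.coord v → Ω'.coord v)
    (u : Finset V) : Prop where
  isSystem : Ω'.IsSystem σ (LowerSet.Iio u)
  dominant_top : ∀ v (hv : v ⊂ u),
    Dominant (fun i : Ω'.coord v => (⟨⟨v, hv⟩, i⟩ : Ω'.BdCoord u)) (Ω'.bdPts σ u) (Ω'.pts σ v)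
  injective : ∀ v, v ⊂ u → Function.Injective (j v)
  comm : ∀ {v v'} (h : v ⊆ v'), v' ⊂ u → ∀ i, j v' (Ω.emb h i) = Ω'.emb h (j v i)
  projects : ∀ v, v ⊂ u → Projects (j v) (Ω'.pts σ v) (Ω.pts σ v)
  finite : ∀ v, v ⊂ u → FiniteProj (j v) (Ω'.pts σ v)
  dominant : ∀ v, v ⊂ u → Dominant (j v) (Ω'.pts σ v) (Ω.pts σ v)
  finite_bd : FiniteProj (bdMap j u) (Ω'.bdPts σ u)
  dominant_bd : Dominant (bdMap j u) (Ω'.bdPts σ u) (Ω.bdPts σ u)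

/-- `D` bounds the degrees of `Ω`: the numbers of coordinates, the numbers, orders and degrees of the
defining difference equations, and the degrees (largest numbers of points in a fibre) of the finite
covers `Ω(u) → Ω(u)⁻`. -/
structure DegreeLE (D : ℕ) : Prop where
  card_coord : ∀ v, Fintype.card (Ω.coord v) ≤ D
  card_eqs : ∀ v, (Ω.eqs v).ncard ≤ D
  order : ∀ v, ∀ p ∈ Ω.eqs v, ∀ m ∈ p.vars, m.2 ≤ D
  totalDegree : ∀ v, ∀ p ∈ Ω.eqs v, p.totalDegree ≤ D
  cover : ∀ v, 2 ≤ v.card → ∀ (L : DiffExt A σ) (a : Ω.BdCoord v → L.K),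
    {x ∈ Ω.pts σ v L | x ∘ Ω.bdEmb v = a}.encard ≤ D

/-- The least bound for the degrees of `Ω`. -/
def degree : ℕ := sInf {D | Ω.DegreeLE σ D}

end Systems

end VarDiagram

/-! ## Frobenius specialisations -/

section Specialisation

variable {A : Type u} [Field A] {V : Type w}

/-- `R` is a finitely generated difference subring of `(A, σ)`. -/
def IsFGDiffSubring (σ : A ≃+* A) (R : Subring A) : Prop :=
  ∃ s : Finset A, R = Subring.closure {y | ∃ a ∈ s, ∃ n : ℕ, y = σ^[n] a}

/-- All coefficients of the equations of `Ω` lie in `R`. -/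
def VarDiagram.DefinedOver (Ω : VarDiagram A V) (R : Subring A) : Prop :=
  ∀ v, ∀ p ∈ Ω.eqs v, ∀ m, p.coeff m ∈ R

/-- The points in the field `k` with the operator `y ↦ y ^ q` of the variety obtained from `Ω(v)` by
applying `h : R → k` to the coefficients of the equations. -/
def VarDiagram.specPts (Ω : VarDiagram A V) {R : Subring A} {k : Type*} [Field k] (h : R →+* k)
    (q : ℕ) (v : Finset V) : Set (Ω.coord v → k) :=
  {x | ∀ p : MvPolynomial (Ω.coord v × ℕ) R, MvPolynomial.map R.subtype p ∈ Ω.eqs v →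
    MvPolynomial.eval₂ h (jet (fun y => y ^ q) x) p = 0}

/-- `Q` holds for almost all `q`: there is a finitely generated difference subring `R` of `A` over
which the data are defined (`Def R`) such that for every sufficiently large prime power `q` and every
homomorphism `h` of difference rings from `R` to `K_q` (the algebraic closure of the field with `q`
elements, with the operator `y ↦ y ^ q`), `Q` holds at `h`. -/
def AlmostAll (σ : A ≃+* A) (Def : Subring A → Prop)
    (Q : ∀ (R : Subring A) (p : ℕ) [Fact p.Prime] (_ : ℕ),
      (R →+* AlgebraicClosure (ZMod p)) → Prop) : Prop :=
  ∃ R : Subring A, IsFGDiffSubring σ R ∧ Def R ∧ ∃ q₀ : ℕ,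
    ∀ (p : ℕ) [Fact p.Prime] (n : ℕ), 0 < n → q₀ ≤ p ^ n →
      ∀ h : R →+* AlgebraicClosure (ZMod p),
        (∀ r s : R, (s : A) = σ r → h s = h r ^ (p ^ n)) → Q R p (p ^ n) h

/-! ## Edge-uniformity and quasirandomness -/

/-- `Ω` is `ε`-étale-edge-uniform, with the constant `C` in the error terms. (The ratios are formed
when `φ_u` has a point.) -/
def EtaleEdgeUniformWith (σ : A ≃+* A) (Ω : VarDiagram A V) (ε : Finset V → ℕ → ℝ≥0) (C : ℝ) :
    Prop :=
  ∀ u : Finset V, 2 ≤ u.card →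
  ∀ (A' : Type u) [Field A'] [PerfectField A'] [Algebra A A'] [Algebra.IsAlgebraic A A']
    (σ' : A' ≃+* A'), (∀ a, σ' (algebraMap A A' a) = algebraMap A A' (σ a)) →
    (∃ s : Finset A',
      IntermediateField.adjoin A {y : A' | ∃ a ∈ s, ∃ n : ℤ, y = (σ' ^ n : RingAut A') a} = ⊤) →
  ∀ (Ω' : VarDiagram A' V) (j : ∀ v, Ω.coord v → Ω'.coord v),
    VarDiagram.IsBdRefinement σ' (Ω.baseChange A') Ω' j u →
  AlmostAll σ' (fun R => (Ω.baseChange A').DefinedOver R ∧ Ω'.DefinedOver R)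
    fun _ _ _ q h =>
      let S := (Ω.baseChange A').specPts h q
      let S' := Ω'.specPts h q
      ∀ W, Ω'.IsChain S' W u →
        let φ := (Ω.baseChange A').phi S u
        let πW := (fun a => a ∘ VarDiagram.bdMap (Ω := Ω.baseChange A') (Ω' := Ω') j u) ''
          Ω'.fibreProd W u
        φ.Nonempty →
          |((φ ∩ πW).ncard : ℝ) / (φ.ncard : ℝ) -
            (πW.ncard : ℝ) / (((Ω.baseChange A').fibreProd S u).ncard : ℝ)| ≤ C * ε u q

/-- `Ω` is `ε`-quasirandom, with the constant `C` in the error terms. The finiteness of the sets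
concerned is part of the definition. -/
def QuasirandomWith [DecidableEq V] (σ : A ≃+* A) (Ω : VarDiagram A V)
    (ε : Finset V → ℕ → ℝ≥0) (C : ℝ) : Prop :=
  AlmostAll σ Ω.DefinedOver fun _ _ _ q h =>
    let S := Ω.specPts h q
    ∀ u : Finset V, 2 ≤ u.card →
      (S u).Finite ∧ (Ω.fibreProd S u).Finite ∧ (Ω.doubling S u).Finite ∧
      |∑ᶠ z ∈ Ω.doubling S u, ∏ κ : u → Bool, Ω.balanced S u (Ω.vertex z κ)| ≤
        C * ε u q * ((Ω.fibreProd S u).ncard : ℝ) ^ 2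

end Specialisation

end DiffHyper

/-!
Quasirandomness bounds a box norm of `f_u`, and the proof is the usual one: the box norm of a
function is controlled by its correlations with products of functions of fewer variables, which here
are the indicator functions of chains.

Fix a specialisation and write `S` for its sets of points. A point `z` of the doubling is sorted by
its vertex `y = z_(1,…,1)`, by the number of each component `z v κ` within its fibre over `S(v)⁻`,
and by the set of those `κ ≠ 0` with `z_κ ∈ φ_u`. If `y`, the numbers and that set are fixed, then
`z v κ` is a function of the component of `z_(0,…,0)` at the zeros of `κ`, a proper subset of `u`
(`cell_local`). Hence on such a cell `∏_{κ ≠ 0} f_u(z_κ)` is constant, and `z ↦ z_(0,…,0)` is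
a bijection onto the fibre product of a chain (`bijOn_cell`), so that edge-uniformity bounds the sum
over the cell by a multiple of `|S(u)⁻|`. There are boundedly many cells for each of the `|S(u)⁻|`
points `y`, which gives `abs_sum_doubling_le`. As the sets in a chain need not be definable, the
numbering can be arbitrary, and it is enough to use edge-uniformity for `Ω` as a refinement of itself
(`IsSystem.isBdRefinement_self`).

What this uses about almost all specialisations, namely that the `S(v)` are finite, that
the projections map `S(v')` to `S(v)`, and that the covers `S(v) → S(v)⁻` have fibres bounded by the
degree of `Ω`, is obtained from an ultraproduct of specialisations, which is a difference field
extension of `A` (`exists_isUltraproduct_site`, `mk_mem_pts_iff`). For finiteness, bounded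
transcendence degree yields finitely many nontrivial difference equations one of which holds at each
point, and a nonzero difference polynomial over the algebraic closure of `ZMod p` has finitely many zeros
for large `q`. That the degree of `Ω` is a bound at all, that is, that the covers have uniformly
bounded fibres, follows from another ultraproduct (`IsSplittingCover.exists_fibre_bound`).
-/

namespace DiffHyper

/-! ### The doubling and its cells -/

namespace VarDiagram

section Combinatorics

variable {A : Type u} [Field A] {V : Type w} (Ω : VarDiagram A V) {k : Type*}
  (S : ∀ v, Set (Ω.coord v → k)) {u : Finset V}

/-- The points of the affine space that contains the doubling. -/
abbrev DblPt (u : Finset V) (k : Type*) :=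
  ∀ v : {v : Finset V // v ⊂ u}, (v.1 → Bool) → Ω.coord v.1 → k

variable {Ω S}

theorem vertex_mem_fibreProd {z : Ω.DblPt u k} (hz : z ∈ Ω.doubling S u) (κ : u → Bool) :
    Ω.vertex z κ ∈ Ω.fibreProd S u :=
  ⟨fun v hv => hz.1 ⟨v, hv⟩ fun i => κ ⟨i.1, hv.subset i.2⟩, fun v v' h hv' =>
    hz.2 ⟨v, h.trans_ssubset hv'⟩ ⟨v', hv'⟩ h fun i => κ ⟨i.1, hv'.subset i.2⟩⟩

variable (Ω) in
/-- The data by which the points of the doubling are sorted: the vertex `z_(1,…,1)`, the labels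
of all coordinates, and the vertices `z_κ`, `κ ≠ 0`, that lie in `φ`. -/
def cellKey {β : Type*} (ℓ : ∀ v : {v : Finset V // v ⊂ u}, (Ω.coord v.1 → k) → β)
    (φ : Set (Ω.BdCoord u → k)) (z : Ω.DblPt u k) :
    (Ω.BdCoord u → k) × ((v : {v : Finset V // v ⊂ u}) → (v.1 → Bool) → β) ×
      ({κ : u → Bool // ∃ i, κ i = true} → Prop) :=
  (Ω.vertex z fun _ => true, fun v κ => ℓ v (z v κ), fun κ => Ω.vertex z κ.1 ∈ φ)

variable {β : Type*} {ℓ : ∀ v : {v : Finset V // v ⊂ u}, (Ω.coord v.1 → k) → β}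
  {φ : Set (Ω.BdCoord u → k)}

/-- Within a cell the component `z v κ` depends only on the components `z w 0` where `w` contains
the zeros of `κ`: by induction on `v` its boundary does, and its label is prescribed. -/
theorem cell_local
    (hℓ : ∀ v : {v : Finset V // v ⊂ u}, 2 ≤ v.1.card → ∀ x ∈ S v.1, ∀ x' ∈ S v.1,
      x ∘ Ω.bdEmb v.1 = x' ∘ Ω.bdEmb v.1 → ℓ v x = ℓ v x' → x = x')
    {z z' : Ω.DblPt u k} (hz : z ∈ Ω.doubling S u) (hz' : z' ∈ Ω.doubling S u)
    (hk : Ω.cellKey ℓ φ z = Ω.cellKey ℓ φ z') (w : {v : Finset V // v ⊂ u})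
    (hw : z w (fun _ => false) = z' w fun _ => false) (v : {v : Finset V // v ⊂ u})
    (κ : v.1 → Bool) (hκ : ∀ i, κ i = false → i.1 ∈ w.1) : z v κ = z' v κ := by
  obtain ⟨v, hv⟩ := v
  induction v using Finset.strongInduction with
  | H v ih =>
    by_cases h0 : ∀ i, κ i = false
    · have hvw : v ⊆ w.1 := fun i hi => hκ ⟨i, hi⟩ (h0 _)
      have hκ0 : κ = fun _ => false := funext h0
      subst hκ0
      have h1 := hz.2 ⟨v, hv⟩ w hvw fun _ => false
      have h2 := hz'.2 ⟨v, hv⟩ w hvw fun _ => false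
      rw [← h1, ← h2, hw]
    by_cases h1 : ∀ i, κ i = true
    · have hκ1 : κ = fun _ => true := funext h1
      subst hκ1
      funext i
      exact congrFun (congrArg Prod.fst hk) ⟨⟨v, hv⟩, i⟩
    · -- Here `v` has at least two elements, so that the fibre over the boundary determines `z v κ` by its
      -- label.
      push Not at h0 h1
      obtain ⟨i, hi⟩ := h0
      obtain ⟨j, hj⟩ := h1
      have hij : i.1 ≠ j.1 := by
        intro h
        obtain rfl : i = j := Subtype.ext h
        simp_all
      have hcard : 2 ≤ v.card := Finset.one_lt_card.2 ⟨i, i.2, j, j.2, hij⟩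
      refine hℓ ⟨v, hv⟩ hcard _ (hz.1 _ _) _ (hz'.1 _ _) ?_
        (congrFun (congrFun (congrArg (fun c => c.2.1) hk) ⟨v, hv⟩) κ)
      funext ⟨⟨w', hw'⟩, i⟩
      have e1 := hz.2 ⟨w', hw'.trans hv⟩ ⟨v, hv⟩ hw'.subset κ
      have e2 := hz'.2 ⟨w', hw'.trans hv⟩ ⟨v, hv⟩ hw'.subset κ
      have e3 := ih w' hw' (hw'.trans hv) (fun i => κ ⟨i.1, hw'.subset i.2⟩)
        (fun i hi => hκ ⟨i.1, hw'.subset i.2⟩ hi)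
      exact (congrFun e1 i).trans ((congrFun e3 i).trans (congrFun e2 i).symm)

variable (Ω) in
/-- The chain formed by the components `z v 0` of the points `z` of a cell. -/
def cellChain (Z : Set (Ω.DblPt u k)) (v : Finset V) : Set (Ω.coord v → k) :=
  {x | ∃ hv : v ⊂ u, ∃ z ∈ Z, z ⟨v, hv⟩ (fun _ => false) = x}

theorem isChain_cellChain {Z : Set (Ω.DblPt u k)} (hZ : Z ⊆ Ω.doubling S u) :
    Ω.IsChain S (Ω.cellChain Z) u := by
  refine ⟨?_, ?_⟩
  · rintro v - _ ⟨hv, z, hz, rfl⟩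
    exact (hZ hz).1 ⟨v, hv⟩ _
  · rintro v v' h hv' _ ⟨_, z, hz, rfl⟩
    exact ⟨h.trans_ssubset hv', z, hz, 
      ((hZ hz).2 ⟨v, h.trans_ssubset hv'⟩ ⟨v', hv'⟩ h fun _ => false).symm⟩

/-- The set of zeros of `κ : v → {0, 1}`, as a subset of `v`. -/
def zeros {v : Finset V} (κ : v → Bool) : Finset V :=
  (Finset.univ.filter fun i => κ i = false).map (Function.Embedding.subtype _)

theorem mem_zeros {v : Finset V} {κ : v → Bool} {a : V} :
    a ∈ zeros κ ↔ ∃ h : a ∈ v, κ ⟨a, h⟩ = false := by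
  simp [zeros]

theorem zeros_subset {v : Finset V} (κ : v → Bool) : zeros κ ⊆ v := fun _ h =>
  (mem_zeros.1 h).1

/-- The map `z ↦ z_(0,…,0)` is a bijection from a cell onto the fibre product of its chain. A
compatible family of components `x v = z⁽ᵛ⁾ v 0` is glued to the point with components
`z⁽ʷ⁾ v κ`, where `w` is the set of zeros of `κ`. -/
theorem bijOn_cell
    (hℓ : ∀ v : {v : Finset V // v ⊂ u}, 2 ≤ v.1.card → ∀ x ∈ S v.1, ∀ x' ∈ S v.1,
      x ∘ Ω.bdEmb v.1 = x' ∘ Ω.bdEmb v.1 → ℓ v x = ℓ v x' → x = x')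
    (c) (hu : u.Nonempty) :
    Set.BijOn (fun z => Ω.vertex z fun _ => false)
      {z | z ∈ Ω.doubling S u ∧ Ω.cellKey ℓ φ z = c}
      (Ω.fibreProd (Ω.cellChain {z | z ∈ Ω.doubling S u ∧ Ω.cellKey ℓ φ z = c}) u) := by
  refine ⟨?_, ?_, ?_⟩
  · intro z hz
    exact ⟨fun v hv => ⟨hv, z, hz, rfl⟩, fun v v' h hv' =>
      hz.1.2 ⟨v, h.trans_ssubset hv'⟩ ⟨v', hv'⟩ h fun _ => false⟩
  · intro z hz z' hz' h
    funext v κ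
    refine cell_local hℓ hz.1 hz'.1 (hz.2.trans hz'.2.symm) v ?_ v κ fun i _ => i.2
    funext i
    exact congrFun h ⟨v, i⟩
  · rintro a ⟨ha, hcomp⟩
    choose hv g hgZ hg using ha
    have hzs : ∀ {v : {v : Finset V // v ⊂ u}} (κ : v.1 → Bool), zeros κ ⊂ u := fun {v} κ =>
      (zeros_subset κ).trans_ssubset v.2
    -- The points chosen for `w ⊆ w'` agree at the components that are determined by `w`.
    have key : ∀ (w w' : Finset V) (hw : w ⊂ u) (hw' : w' ⊂ u), w ⊆ w' →
        ∀ (v : {v : Finset V // v ⊂ u}) (κ : v.1 → Bool), (∀ i, κ i = false → i.1 ∈ w) →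
          g w hw v κ = g w' hw' v κ := by
      intro w w' hw hw' h v κ hκ
      refine cell_local hℓ (hgZ w hw).1 (hgZ w' hw').1
        ((hgZ w hw).2.trans (hgZ w' hw').2.symm) ⟨w, hw⟩ ?_ v κ hκ
      rw [hg w hw, ← hcomp w w' h hw', ← hg w' hw']
      exact (hgZ w' hw').1.2 ⟨w, hw⟩ ⟨w', hw'⟩ h _
    let z : Ω.DblPt u k := fun v κ => g (zeros κ) (hzs κ) v κ
    have hmem : ∀ {v : Finset V} {κ : v → Bool} (i : v), κ i = false → i.1 ∈ zeros κ :=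
      fun i hi => mem_zeros.2 ⟨i.2, hi⟩
    have hz : ∀ (w : Finset V) (hw : w ⊂ u) (v : {v : Finset V // v ⊂ u}) (κ : v.1 → Bool),
        (∀ i, κ i = false → i.1 ∈ w) → z v κ = g w hw v κ := by
      intro w hw v κ hκ
      refine key _ _ _ _ (fun i hi => ?_) v κ hmem
      obtain ⟨h, h'⟩ := mem_zeros.1 hi
      exact hκ _ h'
    have hvert : ∀ (w : Finset V) (hw : w ⊂ u) (κ : u → Bool),
        (∀ i, κ i = false → i.1 ∈ w) → Ω.vertex z κ = Ω.vertex (g w hw) κ := by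
      intro w hw κ hκ
      funext j
      exact congrFun (hz w hw j.1 _ fun i hi => hκ _ hi) j.2
    have hne : (∅ : Finset V) ⊂ u := Finset.empty_ssubset.2 hu
    have hc := (hgZ ∅ hne).2
    refine ⟨z, ⟨⟨fun v κ => (hgZ _ _).1.1 v κ, fun v v' h κ => ?_⟩, ?_⟩, ?_⟩
    · rw [show z v' κ = g (zeros κ) (hzs κ) v' κ from rfl, (hgZ _ _).1.2 v v' h κ]
      exact (hz _ _ _ _ fun i hi => hmem (κ := κ) ⟨i.1, h i.2⟩ hi).symm
    · refine Prod.ext ?_ (Prod.ext ?_ ?_)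
      · rw [← hc]
        exact hvert ∅ hne (fun _ => true) (by simp)
      · funext v κ
        rw [← (hgZ (zeros κ) (hzs κ)).2]
        rfl
      · funext ⟨κ, i, hi⟩
        have hκ : zeros κ ⊂ u := by
          refine (zeros_subset κ).ssubset_of_ne fun h => ?_
          obtain ⟨_, h'⟩ := mem_zeros.1 (h.symm ▸ i.2 : i.1 ∈ zeros κ)
          simp_all
        rw [← (hgZ (zeros κ) hκ).2]
        simp only [cellKey]
        rw [hvert _ hκ κ hmem]
    · funext ⟨⟨v, hv'⟩, i⟩
      have := (hz v hv' ⟨v, hv'⟩ (fun _ => false) fun i _ => i.2).trans (hg v hv')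
      exact congrFun this i

/-- The number of cells of the doubling over `u` with a given vertex `z_(1,…,1)`, when the points in
a fibre are numbered by `Fin (N + 1)`. -/
def cellCount (u : Finset V) (N : ℕ) : ℕ :=
  Nat.card (((v : {v : Finset V // v ⊂ u}) → (v.1 → Bool) → Fin (N + 1)) ×
      ({κ : u → Bool // ∃ i, κ i = true} → Prop))

theorem abs_balanced_le_one (hX : (Ω.fibreProd S u).Finite) (hφ : Ω.phi S u ⊆ Ω.fibreProd S u)
    (y : Ω.BdCoord u → k) : |Ω.balanced S u y| ≤ 1 := by
  classical
  have h1 : ((Ω.phi S u).ncard : ℝ) / ((Ω.fibreProd S u).ncard : ℝ) ≤ 1 :=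
    div_le_one_of_le₀ (by exact_mod_cast Set.ncard_le_ncard hφ hX) (by positivity)
  have h0 : 0 ≤ ((Ω.phi S u).ncard : ℝ) / ((Ω.fibreProd S u).ncard : ℝ) := by positivity
  unfold balanced
  by_cases hy : y ∈ Ω.phi S u
  · simp only [Set.indicator_of_mem hy, Set.indicator_of_mem (hφ hy), Pi.one_apply]
    rw [abs_le]; constructor <;> linarith
  · by_cases hy' : y ∈ Ω.fibreProd S u
    · simp only [Set.indicator_of_notMem hy, Set.indicator_of_mem hy', Pi.one_apply]
      rw [abs_le]; constructor <;> linarith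
    · simp [Set.indicator_of_notMem hy, Set.indicator_of_notMem hy']

theorem balanced_congr {y y' : Ω.BdCoord u → k} (hy : y ∈ Ω.fibreProd S u)
    (hy' : y' ∈ Ω.fibreProd S u) (h : y ∈ Ω.phi S u ↔ y' ∈ Ω.phi S u) :
    Ω.balanced S u y = Ω.balanced S u y' := by
  classical
  simp only [balanced, Set.indicator_apply, hy, hy', h, Pi.one_apply]

/-- The points of each fibre over the boundary can be numbered by `Fin (N + 1)`. -/
theorem exists_label {v : Finset V} {N : ℕ}
    (hN : ∀ a : Ω.BdCoord v → k, {x ∈ S v | x ∘ Ω.bdEmb v = a}.encard ≤ N) :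
    ∃ ℓ : (Ω.coord v → k) → Fin (N + 1), ∀ x ∈ S v, ∀ x' ∈ S v,
      x ∘ Ω.bdEmb v = x' ∘ Ω.bdEmb v → ℓ x = ℓ x' → x = x' := by
  classical
  have hinj : ∀ a : Ω.BdCoord v → k, ∃ e : (Ω.coord v → k) → Fin (N + 1),
      Set.InjOn e {x ∈ S v | x ∘ Ω.bdEmb v = a} := by
    intro a
    have hf : {x ∈ S v | x ∘ Ω.bdEmb v = a}.Finite := Set.finite_of_encard_le_coe (hN a)
    have := hf.fintype
    have h := hN a
    rw [← Set.coe_fintypeCard] at h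
    have h' : Fintype.card {x ∈ S v | x ∘ Ω.bdEmb v = a} ≤ N := by exact_mod_cast h
    obtain ⟨e⟩ := Function.Embedding.nonempty_of_card_le
      (β := Fin (N + 1)) (h'.trans (by simp))
    refine ⟨fun x => if hx : x ∈ {x ∈ S v | x ∘ Ω.bdEmb v = a} then e ⟨x, hx⟩ else 0, ?_⟩
    intro x hx x' hx' h
    simp only [hx, hx', dif_pos] at h
    exact congrArg Subtype.val (e.injective h)
  choose e he using hinj
  refine ⟨fun x => e (x ∘ Ω.bdEmb v) x, fun x hx x' hx' hxx' h => ?_⟩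
  dsimp only at h
  rw [← hxx'] at h
  exact he _ ⟨hx, rfl⟩ ⟨hx', hxx'.symm⟩ h

/-- On a cell, all factors other than that of `κ = 0` are constant and at most `1` in absolute
value. -/
theorem abs_sum_cell_le
    (hℓ : ∀ v : {v : Finset V // v ⊂ u}, 2 ≤ v.1.card → ∀ x ∈ S v.1, ∀ x' ∈ S v.1,
      x ∘ Ω.bdEmb v.1 = x' ∘ Ω.bdEmb v.1 → ℓ v x = ℓ v x' → x = x')
    [DecidableEq V] (hu : u.Nonempty) (hX : (Ω.fibreProd S u).Finite)
    (hφ : Ω.phi S u ⊆ Ω.fibreProd S u) {η : ℝ}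
    (H : ∀ W, Ω.IsChain S W u →
      |∑ᶠ x ∈ Ω.fibreProd W u, Ω.balanced S u x| ≤ η) (c) :
    |∑ᶠ z ∈ {z | z ∈ Ω.doubling S u ∧ Ω.cellKey ℓ (Ω.phi S u) z = c},
      ∏ κ : u → Bool, Ω.balanced S u (Ω.vertex z κ)| ≤ η := by
  classical
  set Z := {z | z ∈ Ω.doubling S u ∧ Ω.cellKey ℓ (Ω.phi S u) z = c} with hZ
  rcases Z.eq_empty_or_nonempty with h0 | ⟨z₀, hz₀⟩
  · rw [h0]
    simpa using (abs_nonneg _).trans (H (Ω.cellChain ∅) (isChain_cellChain (by simp)))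
  have hprod : ∀ z ∈ Z, ∏ κ : u → Bool, Ω.balanced S u (Ω.vertex z κ) =
      (∏ κ ∈ Finset.univ.erase (fun _ : u => false), Ω.balanced S u (Ω.vertex z₀ κ)) *
        Ω.balanced S u (Ω.vertex z fun _ => false) := by
    intro z hz
    rw [← Finset.mul_prod_erase _ _ (Finset.mem_univ fun _ : u => false), mul_comm]
    congr 1
    refine Finset.prod_congr rfl fun κ hκ => ?_
    refine balanced_congr (vertex_mem_fibreProd hz.1 κ) (vertex_mem_fibreProd hz₀.1 κ) ?_
    have hκ' : ∃ i, κ i = true := by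
      by_contra! h
      exact (Finset.mem_erase.1 hκ).1 (funext fun i => by simpa using h i)
    exact iff_of_eq (congrFun (congrArg (fun d => d.2.2) (hz.2.trans hz₀.2.symm)) ⟨κ, hκ'⟩)
  rw [finsum_mem_congr rfl hprod, ← mul_finsum_mem, abs_mul,
    finsum_mem_eq_of_bijOn (g := fun x => Ω.balanced S u x) _ (bijOn_cell hℓ c hu) fun _ _ => rfl]
  refine (mul_le_of_le_one_left (abs_nonneg _) ?_).trans
    (H _ (isChain_cellChain fun z hz => hz.1))
  rw [Finset.abs_prod]
  exact Finset.prod_le_one (fun _ _ => abs_nonneg _) fun κ _ => abs_balanced_le_one hX hφ _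

theorem finite_fibreProd [Finite V] (hS : ∀ v, (S v).Finite) (u : Finset V) :
    (Ω.fibreProd S u).Finite := by
  refine (Set.Finite.pi' fun j : Ω.BdCoord u =>
    (hS j.1.1).image fun x => x j.2).subset ?_
  intro a ha j
  exact ⟨_, ha.1 j.1.1 j.1.2, rfl⟩

theorem finite_doubling [Finite V] (hS : ∀ v, (S v).Finite) (u : Finset V) :
    (Ω.doubling S u).Finite := by
  refine (Set.Finite.pi' fun v : {v : Finset V // v ⊂ u} =>
    Set.Finite.pi' fun _ : v.1 → Bool => hS v.1).subset ?_
  intro z hz v κ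
  exact hz.1 v κ

/-- If the correlations of `f_u` with chains are at most `η`, then the sum over the doubling is at
most `η` times the number of cells. -/
theorem abs_sum_doubling_le [Finite V] [DecidableEq V] {N : ℕ}
    (hN : ∀ v : Finset V, 2 ≤ v.card → ∀ a : Ω.BdCoord v → k,
      {x ∈ S v | x ∘ Ω.bdEmb v = a}.encard ≤ N)
    (hu : u.Nonempty) (hS : ∀ v, (S v).Finite)
    (hφ : Ω.phi S u ⊆ Ω.fibreProd S u) {η : ℝ}
    (H : ∀ W, Ω.IsChain S W u →
      |∑ᶠ x ∈ Ω.fibreProd W u, Ω.balanced S u x| ≤ η) :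
    |∑ᶠ z ∈ Ω.doubling S u, ∏ κ : u → Bool, Ω.balanced S u (Ω.vertex z κ)| ≤
      ((Ω.fibreProd S u).ncard * cellCount u N : ℕ) * η := by
  classical
  have hℓ : ∀ v : {v : Finset V // v ⊂ u}, ∃ ℓ : (Ω.coord v.1 → k) → Fin (N + 1),
      2 ≤ v.1.card → ∀ x ∈ S v.1, ∀ x' ∈ S v.1,
        x ∘ Ω.bdEmb v.1 = x' ∘ Ω.bdEmb v.1 → ℓ x = ℓ x' → x = x' := by
    intro v
    by_cases hv : 2 ≤ v.1.card
    · obtain ⟨ℓ, h⟩ := exists_label (hN v.1 hv)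
      exact ⟨ℓ, fun _ => h⟩
    · exact ⟨fun _ => 0, fun h => absurd h hv⟩
  choose ℓ hℓ using hℓ
  have hX := finite_fibreProd hS u
  have hD := finite_doubling hS u
  have := Fintype.ofFinite (((v : {v : Finset V // v ⊂ u}) → (v.1 → Bool) → Fin (N + 1)) ×
      ({κ : u → Bool // ∃ i, κ i = true} → Prop))
  rw [finsum_mem_eq_finite_toFinset_sum _ hD,
    ← Finset.sum_fiberwise_of_maps_to (t := hX.toFinset ×ˢ Finset.univ)
      (g := Ω.cellKey ℓ (Ω.phi S u))
      (fun z hz => by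
        simpa [cellKey] using vertex_mem_fibreProd (hD.mem_toFinset.1 hz) _)]
  refine (Finset.abs_sum_le_sum_abs _ _).trans
    ((Finset.sum_le_card_nsmul _ _ η fun c _ => ?_).trans_eq ?_)
  · refine le_of_eq_of_le ?_ (abs_sum_cell_le hℓ hu hX hφ H c)
    rw [finsum_mem_eq_finite_toFinset_sum _ (hD.subset fun z hz => hz.1)]
    congr 2
    ext z
    simp
  · rw [Finset.card_product, ← Set.ncard_eq_toFinset_card _ hX, nsmul_eq_mul, cellCount,
      Nat.card_eq_fintype_card, Finset.card_univ]

/-- Correlation of `f_u` with a set of points of `Ω(u)⁻`. -/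
theorem finsum_balanced {Y : Set (Ω.BdCoord u → k)} (hX : (Ω.fibreProd S u).Finite)
    (hY : Y ⊆ Ω.fibreProd S u) :
    ∑ᶠ x ∈ Y, Ω.balanced S u x = ((Ω.phi S u ∩ Y).ncard : ℝ) -
      ((Ω.phi S u).ncard : ℝ) / ((Ω.fibreProd S u).ncard : ℝ) * Y.ncard := by
  classical
  have hYf := hX.subset hY
  have h1 : ∀ x ∈ Y, Ω.balanced S u x = (Ω.phi S u).indicator 1 x -
      ((Ω.phi S u).ncard : ℝ) / ((Ω.fibreProd S u).ncard : ℝ) := by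
    intro x hx
    simp [balanced, Set.indicator_of_mem (hY hx)]
  rw [finsum_mem_congr rfl h1, finsum_mem_eq_finite_toFinset_sum _ hYf, Finset.sum_sub_distrib,
    Finset.sum_const, nsmul_eq_mul, ← Set.ncard_eq_toFinset_card _ hYf, mul_comm]
  congr 1
  simp only [Set.indicator_apply, Pi.one_apply]
  rw [Finset.sum_boole, ← Set.ncard_coe_finset]
  congr 2
  ext x
  simp [and_comm]

theorem abs_finsum_balanced_le {Y : Set (Ω.BdCoord u → k)} (hX : (Ω.fibreProd S u).Finite)
    (hφ : Ω.phi S u ⊆ Ω.fibreProd S u) (hY : Y ⊆ Ω.fibreProd S u) {η : ℝ} (hη : 0 ≤ η)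
    (H : (Ω.phi S u).Nonempty → |((Ω.phi S u ∩ Y).ncard : ℝ) / ((Ω.phi S u).ncard : ℝ) -
      (Y.ncard : ℝ) / ((Ω.fibreProd S u).ncard : ℝ)| ≤ η) :
    |∑ᶠ x ∈ Y, Ω.balanced S u x| ≤ (Ω.fibreProd S u).ncard * η := by
  rw [finsum_balanced hX hY]
  rcases (Ω.phi S u).eq_empty_or_nonempty with h0 | h0
  · simp only [h0, Set.empty_inter, Set.ncard_empty, Nat.cast_zero, zero_div, zero_mul, sub_self,
      abs_zero]
    positivity
  · have hpos : (0 : ℝ) < (Ω.phi S u).ncard := by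
      exact_mod_cast (Set.ncard_pos (hX.subset hφ)).2 h0
    have hle : ((Ω.phi S u).ncard : ℝ) ≤ (Ω.fibreProd S u).ncard := by
      exact_mod_cast Set.ncard_le_ncard hφ hX
    calc _ = ((Ω.phi S u).ncard : ℝ) * |((Ω.phi S u ∩ Y).ncard : ℝ) / ((Ω.phi S u).ncard : ℝ) -
          (Y.ncard : ℝ) / ((Ω.fibreProd S u).ncard : ℝ)| := by
          rw [← abs_of_pos hpos, ← abs_mul, abs_of_pos hpos]
          congr 1
          field_simp
      _ ≤ _ := by
          gcongr
          exact H h0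

theorem fibreProd_mono {W : ∀ v, Set (Ω.coord v → k)} (h : ∀ v, v ⊂ u → W v ⊆ S v) :
    Ω.fibreProd W u ⊆ Ω.fibreProd S u := fun _ ha =>
  ⟨fun v hv => h v hv (ha.1 v hv), ha.2⟩

end Combinatorics
end VarDiagram

/-! ### Transcendence degree and the trivial refinement -/

section Trdeg

open AlgebraicIndependent

theorem isAlgebraic_algebraAdjoin_iff {A L : Type*} [Field A] [Field L] [Algebra A L] {S : Set L}
    {a : L} :
    IsAlgebraic (Algebra.adjoin A S) a ↔ IsAlgebraic (IntermediateField.adjoin A S) a := by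
  open scoped IntermediateField.algebraAdjoinAdjoin in
  exact IsFractionRing.isAlgebraic_iff (Algebra.adjoin A S) (IntermediateField.adjoin A S) L

/-- Closure in the matroid of algebraic independence is relative algebraic closure. -/
theorem mem_matroid_closure_iff {A L : Type*} [Field A] [Field L] [Algebra A L] {S : Set L}
    {a : L} :
    a ∈ (matroid A L).closure S ↔ IsAlgebraic (IntermediateField.adjoin A S) a := by
  rw [matroid_closure_eq]
  exact isAlgebraic_algebraAdjoin_iff

theorem toENat_trdeg_intermediateField {A L : Type*} [Field A] [Field L] [Algebra A L]
    (E : IntermediateField A L) :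
    Cardinal.toENat (Algebra.trdeg A E) = (matroid A L).eRk (E : Set L) := by
  rw [← matroid_cRank_eq, Matroid.toENat_cRank_eq, ← Matroid.eRk_ground, matroid_e]
  have key : ∀ I : Set E, (matroid A E).Indep I ↔ (matroid A L).Indep (Subtype.val '' I) := by
    intro I
    have h : AlgebraicIndependent A (fun x : Subtype.val '' I => (x : L)) ↔
        AlgebraicIndependent A (fun x : I => ((x : E) : L)) :=
      (algebraicIndependent_image Subtype.val_injective.injOn).symm
    exact (h.trans (AlgHom.algebraicIndependent_iff E.val E.val.injective)).symm
  refine le_antisymm ?_ ?_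
  · refine Matroid.eRk_le_iff.2 fun I _ hI => ?_
    rw [← Subtype.val_injective.encard_image]
    exact ((key I).1 hI).encard_le_eRk_of_subset (by rintro _ ⟨x, -, rfl⟩; exact x.2)
  · refine Matroid.eRk_le_iff.2 fun I hIE hI => ?_
    have hI' : Subtype.val '' (Subtype.val ⁻¹' I : Set E) = I :=
      Set.image_preimage_eq_of_subset (by simpa using hIE)
    rw [← hI'] at hI ⊢
    rw [Subtype.val_injective.encard_image]
    exact ((key _).2 hI).encard_le_eRk_of_subset (Set.subset_univ _)

theorem toENat_trdeg_adjoin {A L : Type*} [Field A] [Field L] [Algebra A L] (S : Set L) :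
    Cardinal.toENat (Algebra.trdeg A (IntermediateField.adjoin A S)) = (matroid A L).eRk S := by
  rw [toENat_trdeg_intermediateField]
  refine le_antisymm ?_ (Matroid.eRk_mono _ (IntermediateField.subset_adjoin A S))
  rw [← Matroid.eRk_closure_eq _ S]
  refine Matroid.eRk_mono _ fun a ha => mem_matroid_closure_iff.2 ?_
  exact isAlgebraic_algebraMap (⟨a, ha⟩ : IntermediateField.adjoin A S)

variable {A : Type u} [Field A] {σ : A ≃+* A}

theorem trdegAt_eq_eRk (L : DiffExt A σ) {ι : Type*} (x : ι → L.K) :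
    trdegAt L x = (matroid A L.K).eRk (Set.range (jet L.τ x)) :=
  toENat_trdeg_adjoin _

theorem jet_comp {K ι κ : Type*} (τ : K → K) (x : κ → K) (f : ι → κ) :
    jet τ (x ∘ f) = jet τ x ∘ Prod.map f id := rfl

theorem range_jet_comp_subset {K ι κ : Type*} (τ : K → K) (x : κ → K) (f : ι → κ) :
    Set.range (jet τ (x ∘ f)) ⊆ Set.range (jet τ x) := by
  rw [jet_comp]
  exact Set.range_comp_subset_range _ _

theorem trdegAt_comp_le (L : DiffExt A σ) {ι κ : Type*} (x : κ → L.K) (f : ι → κ) :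
    trdegAt L (x ∘ f) ≤ trdegAt L x := by
  rw [trdegAt_eq_eRk, trdegAt_eq_eRk]
  exact Matroid.eRk_mono _ (range_jet_comp_subset _ _ _)

theorem trdegAt_le_of_isAlgebraic (L : DiffExt A σ) {ι κ : Type*} (x : κ → L.K) (y : ι → L.K)
    (h : ∀ r ∈ Set.range (jet L.τ x), IsAlgebraic (diffAdjoin L y) r) :
    trdegAt L x ≤ trdegAt L y := by
  rw [trdegAt_eq_eRk, trdegAt_eq_eRk, ← Matroid.eRk_closure_eq _ (Set.range (jet L.τ y))]
  exact Matroid.eRk_mono _ fun a ha => mem_matroid_closure_iff.2 (h a ha)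

/-- Algebraic independence of jet coordinates is decided by the vanishing ideal. -/
theorem trdegAt_le_of_vanishingIdeal_eq {L L' : DiffExt A σ} {ι : Type*} {x : ι → L.K}
    {y : ι → L'.K} (h : vanishingIdeal L x = vanishingIdeal L' y) :
    trdegAt L x ≤ trdegAt L' y := by
  rw [trdegAt_eq_eRk, trdegAt_eq_eRk]
  refine Matroid.eRk_le_iff.2 fun I hI hind => ?_
  obtain ⟨J, hJ⟩ := Set.SurjOn.exists_bijOn_subset (f := jet L.τ x) (s := Set.univ) (t := I)
    (by simpa [Set.SurjOn] using hI)
  obtain ⟨-, hbij⟩ := hJ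
  have hx : AlgebraicIndependent A (fun j : J => jet L.τ x j) := by
    rw [algebraicIndependent_image hbij.injOn, hbij.image_eq]
    exact hind
  have hy : AlgebraicIndependent A (fun j : J => jet L'.τ y j) := by
    rw [algebraicIndependent_iff] at hx ⊢
    intro p hp
    refine hx p ?_
    have h1 : MvPolynomial.rename Subtype.val p ∈ vanishingIdeal L' y := by
      rw [vanishingIdeal, RingHom.mem_ker, MvPolynomial.aeval_rename]
      exact hp
    rw [← h, vanishingIdeal, RingHom.mem_ker, MvPolynomial.aeval_rename] at h1
    exact h1
  have hinj : Set.InjOn (jet L'.τ y) J := Set.injOn_iff_injective.2 hy.injective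
  rw [algebraicIndependent_image hinj] at hy
  have h2 : ((matroid A L'.K).Indep (jet L'.τ y '' J)) := hy
  rw [← hbij.image_eq, hbij.injOn.encard_image, ← hinj.encard_image]
  exact h2.encard_le_eRk_of_subset (Set.image_subset_range _ _)

theorem trdegAt_congr {L L' : DiffExt A σ} {ι : Type*} {x : ι → L.K} {y : ι → L'.K}
    (h : vanishingIdeal L x = vanishingIdeal L' y) : trdegAt L x = trdegAt L' y :=
  le_antisymm (trdegAt_le_of_vanishingIdeal_eq h) (trdegAt_le_of_vanishingIdeal_eq h.symm)

theorem trdegAt_le_totalDim {ι : Type*} (X : PointSet σ ι) {L : DiffExt A σ} {x : ι → L.K}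
    (hx : x ∈ X L) : trdegAt L x ≤ totalDim X :=
  le_iSup_of_le L (le_iSup_of_le x (le_iSup_of_le hx le_rfl))

/-- A coordinate of a point of transcendence degree at most `d` satisfies a nontrivial difference
equation of order at most `d`. -/
theorem exists_aeval_eq_zero_of_trdegAt_le {L : DiffExt A σ} {ι : Type*} {x : ι → L.K} {d : ℕ}
    (h : trdegAt L x ≤ d) (i : ι) :
    ∃ f : MvPolynomial (Fin (d + 1)) A, f ≠ 0 ∧
      MvPolynomial.aeval (fun n : Fin (d + 1) => L.τ^[n] (x i)) f = 0 := by
  by_contra! hne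
  have hind : AlgebraicIndependent A (fun n : Fin (d + 1) => L.τ^[n] (x i)) :=
    algebraicIndependent_iff.2 fun p hp => by_contra fun h0 => hne p h0 hp
  have h1 : (matroid A L.K).Indep (Set.range fun n : Fin (d + 1) => L.τ^[n] (x i)) :=
    hind.to_subtype_range
  have h2 := h1.encard_le_eRk_of_subset (X := Set.range (jet L.τ x))
    (by rintro _ ⟨n, rfl⟩; exact ⟨(i, n), rfl⟩)
  rw [← trdegAt_eq_eRk, ← Set.image_univ, hind.injective.encard_image, Set.encard_univ,
    ENat.card_eq_coe_fintype_card, Fintype.card_fin] at h2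
  have h3 : ((d + 1 : ℕ) : ℕ∞) ≤ (d : ℕ) := h2.trans h
  have : d + 1 ≤ d := by exact_mod_cast h3
  omega

/-- The transcendence degree is subadditive. -/
theorem trdegAt_sigma_le {L : DiffExt A σ} {I : Type*} [Fintype I] {κ : I → Type*}
    (x : (Σ i, κ i) → L.K) :
    trdegAt L x ≤ ∑ i, trdegAt L (fun j => x ⟨i, j⟩) := by
  classical
  have hU : Set.range (jet L.τ x) ⊆
      ⋃ i ∈ (Finset.univ : Finset I), Set.range (jet L.τ fun j => x ⟨i, j⟩) := by
    rintro _ ⟨⟨⟨i, j⟩, n⟩, rfl⟩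
    simp only [Finset.mem_univ, Set.iUnion_true, Set.mem_iUnion]
    exact ⟨i, (j, n), rfl⟩
  rw [trdegAt_eq_eRk]
  refine (Matroid.eRk_mono _ hU).trans ?_
  simp only [trdegAt_eq_eRk]
  generalize (Finset.univ : Finset I) = s
  induction s using Finset.induction_on with
  | empty => simp
  | insert a s ha ih =>
    rw [Finset.set_biUnion_insert, Finset.sum_insert ha]
    exact (Matroid.eRk_union_le_eRk_add_eRk _ _ _).trans (by gcongr)

end Trdeg

namespace VarDiagram

variable {A : Type u} [Field A] {V : Type w} {Ω : VarDiagram A V} {σ : A ≃+* A}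

/-- In a splitting cover, the field generated by a point is algebraic over the field generated by
its image. -/
theorem IsSplittingCover.isAlgebraic {u : Finset V} (h : Ω.IsSplittingCover σ u)
    {L : DiffExt A σ} {x : Ω.coord u → L.K} (hx : x ∈ Ω.pts σ u L) {r : L.K}
    (hr : r ∈ diffAdjoin L x) : IsAlgebraic (diffAdjoin L (x ∘ Ω.bdEmb u)) r := by
  obtain ⟨P, -, hP⟩ := h
  obtain ⟨-, heq⟩ := hP L x hx
  rw [heq] at hr
  set E := diffAdjoin L (x ∘ Ω.bdEmb u) with hE
  have hle : IntermediateField.adjoin A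
      (Set.range (jet L.τ (x ∘ Ω.bdEmb u)) ∪ {r | ∃ f ∈ P, r ∈ (f.map
        (MvPolynomial.aeval (jet L.τ (x ∘ Ω.bdEmb u)) :
          MvPolynomial (Ω.BdCoord u × ℕ) A →ₐ[A] L.K).toRingHom).roots}) ≤
      (algebraicClosure E L.K).restrictScalars A := by
    refine IntermediateField.adjoin_le_iff.2 ?_
    rintro s (hs | ⟨f, -, hs⟩)
    · refine mem_algebraicClosure_iff.2 ?_
      exact isAlgebraic_algebraMap (⟨s, IntermediateField.subset_adjoin _ _ hs⟩ : E)
    · refine mem_algebraicClosure_iff.2 ?_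
      have hmem : ∀ p : MvPolynomial (Ω.BdCoord u × ℕ) A,
          MvPolynomial.aeval (jet L.τ (x ∘ Ω.bdEmb u)) p ∈ E := fun p =>
        IntermediateField.algebra_adjoin_le_adjoin _ _
          (Algebra.adjoin_range_eq_range_aeval A (jet L.τ (x ∘ Ω.bdEmb u)) ▸ ⟨p, rfl⟩)
      let ev : MvPolynomial (Ω.BdCoord u × ℕ) A →ₐ[A] E :=
        (MvPolynomial.aeval (jet L.τ (x ∘ Ω.bdEmb u))).codRestrict E.toSubalgebra hmem
      have hev : (MvPolynomial.aeval (jet L.τ (x ∘ Ω.bdEmb u)) :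
          MvPolynomial (Ω.BdCoord u × ℕ) A →ₐ[A] L.K).toRingHom =
          (algebraMap E L.K).comp ev.toRingHom := RingHom.ext fun p => rfl
      obtain ⟨h0, hroot⟩ := Polynomial.mem_roots'.1 hs
      refine ⟨f.map ev.toRingHom, fun h => h0 ?_, ?_⟩
      · rw [hev, ← Polynomial.map_map, h, Polynomial.map_zero]
      · rw [Polynomial.aeval_def, Polynomial.eval₂_map, ← hev, ← Polynomial.eval_map]
        exact hroot
  exact mem_algebraicClosure_iff.1 (hle hr)

theorem jet_mem_diffAdjoin {L : DiffExt A σ} {ι : Type*} (x : ι → L.K) {r : L.K}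
    (hr : r ∈ Set.range (jet L.τ x)) : r ∈ diffAdjoin L x :=
  IntermediateField.subset_adjoin _ _ hr

theorem IsSplittingCover.trdegAt_bd {u : Finset V} (h : Ω.IsSplittingCover σ u)
    {L : DiffExt A σ} {x : Ω.coord u → L.K} (hx : x ∈ Ω.pts σ u L) :
    trdegAt L (x ∘ Ω.bdEmb u) = trdegAt L x :=
  le_antisymm (trdegAt_comp_le _ _ _) (trdegAt_le_of_isAlgebraic _ _ _ fun _ hr =>
    h.isAlgebraic hx (jet_mem_diffAdjoin x hr))

/-- The projection `ρ_u` maps `Ω(u)` to `Ω(u)⁻`. -/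
theorem IsSystem.bd_mem (hΩ : Ω.IsSystem σ ⊤) {u : Finset V} {L : DiffExt A σ}
    {x : Ω.coord u → L.K} (hx : x ∈ Ω.pts σ u L) : x ∘ Ω.bdEmb u ∈ Ω.bdPts σ u L := by
  refine ⟨fun v hv => hΩ.projects hv.subset trivial L x hx, fun v v' h hv' => ?_⟩
  funext i
  exact congrArg x (hΩ.emb_trans h hv'.subset trivial i).symm

theorem IsSystem.totalDim_bd_lt_top [Finite V] (hΩ : Ω.IsSystem σ ⊤) (u : Finset V) :
    totalDim (Ω.bdPts σ u) < ⊤ := by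
  have := Fintype.ofFinite {v : Finset V // v ⊂ u}
  refine lt_of_le_of_lt (b := ∑ v : {v : Finset V // v ⊂ u}, totalDim (Ω.pts σ v.1)) ?_
    (WithTop.sum_lt_top.2 fun v _ => hΩ.dim_lt_top v.1 trivial)
  refine iSup_le fun L => iSup_le fun x => iSup_le fun hx => (trdegAt_sigma_le x).trans ?_
  exact Finset.sum_le_sum fun v _ => trdegAt_le_totalDim _ (hx.1 v.1 v.2)

/-- A finite total dimension is attained. -/
theorem exists_trdegAt_eq_totalDim {ι : Type*} {X : PointSet σ ι} (h : totalDim X < ⊤)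
    {L₀ : DiffExt A σ} {x₀ : ι → L₀.K} (hx₀ : x₀ ∈ X L₀) :
    ∃ L : DiffExt A σ, ∃ x ∈ X L, trdegAt L x = totalDim X := by
  have : Nonempty {p : Σ L : DiffExt A σ, ι → L.K // p.2 ∈ X p.1} := ⟨⟨⟨L₀, x₀⟩, hx₀⟩⟩
  have heq : totalDim X = ⨆ p : {p : Σ L : DiffExt A σ, ι → L.K // p.2 ∈ X p.1},
      trdegAt p.1.1 p.1.2 := by
    refine le_antisymm ?_ ?_
    · exact iSup_le fun L => iSup_le fun x => iSup_le fun hx =>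
        le_iSup (fun p : {p : Σ L : DiffExt A σ, ι → L.K // p.2 ∈ X p.1} =>
          trdegAt p.1.1 p.1.2) ⟨⟨L, x⟩, hx⟩
    · exact iSup_le fun p => trdegAt_le_totalDim X p.2
  obtain ⟨p, hp⟩ := ENat.exists_eq_iSup_of_lt_top (heq ▸ h)
  exact ⟨p.1.1, p.1.2, p.2, hp.trans heq.symm⟩

theorem IsSystem.totalDim_bd_le [Finite V] (hΩ : Ω.IsSystem σ ⊤) {u : Finset V}
    (hu : 2 ≤ u.card) : totalDim (Ω.bdPts σ u) ≤ totalDim (Ω.pts σ u) := by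
  by_cases hne : ∃ L : DiffExt A σ, ∃ x, x ∈ Ω.bdPts σ u L
  · obtain ⟨L₀, x₀, hx₀⟩ := hne
    obtain ⟨L, a, ha, hmax⟩ := exists_trdegAt_eq_totalDim (hΩ.totalDim_bd_lt_top u) hx₀
    obtain ⟨L', x, hx, -, hv⟩ := hΩ.dominant_bd u trivial hu L a ha hmax
    rw [← hmax, ← trdegAt_congr hv]
    exact (trdegAt_comp_le _ _ _).trans (trdegAt_le_totalDim _ hx)
  · push Not at hne
    exact iSup_le fun L => iSup_le fun x => iSup_le fun hx => absurd hx (hne L x)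

theorem finiteProj_id {ι : Type*} (X : PointSet σ ι) : FiniteProj (fun i => i) X := by
  intro L x _ i
  exact isAlgebraic_algebraMap
    (⟨x i, jet_mem_diffAdjoin x ⟨(i, 0), rfl⟩⟩ : diffAdjoin L (x ∘ fun i => i))

theorem dominant_id {ι : Type*} (X : PointSet σ ι) : Dominant (fun i => i) X X :=
  fun L y hy h => ⟨L, y, hy, h, rfl⟩

/-- A system is a refinement of itself: the projections of `Ω(u)⁻` are dominant since
`Ω(u)⁻` has the dimension of its finite cover `Ω(u)`. -/
theorem IsSystem.isBdRefinement_self [Finite V] (hΩ : Ω.IsSystem σ ⊤) {u : Finset V}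
    (hu : 2 ≤ u.card) : IsBdRefinement σ Ω Ω (fun _ i => i) u where
  isSystem :=
    { emb_injective h _ := hΩ.emb_injective h trivial
      emb_refl _ := hΩ.emb_refl trivial
      emb_trans h h' _ := hΩ.emb_trans h h' trivial
      empty_coord := hΩ.empty_coord
      empty_pts := hΩ.empty_pts
      dim_lt_top v _ := hΩ.dim_lt_top v trivial
      dim_pos v _ := hΩ.dim_pos v trivial
      projects h _ := hΩ.projects h trivial
      dominant h _ := hΩ.dominant h trivial
      splitting v _ := hΩ.splitting v trivial
      dominant_bd v _ := hΩ.dominant_bd v trivial }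
  dominant_top v hv L y hy hmax := by
    obtain ⟨L', x, hx, hx', hxy⟩ := hΩ.dominant hv.subset trivial L y hy hmax
    refine ⟨L', x ∘ Ω.bdEmb u, hΩ.bd_mem hx, ?_, hxy⟩
    refine le_antisymm (trdegAt_le_totalDim _ (hΩ.bd_mem hx)) ?_
    rw [(hΩ.splitting u trivial hu).trdegAt_bd hx, hx']
    exact hΩ.totalDim_bd_le hu
  injective _ _ := Function.injective_id
  comm _ _ _ := rfl
  projects _ _ _ _ hx := hx
  finite v _ := finiteProj_id _
  dominant v _ := dominant_id _
  finite_bd := finiteProj_id _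
  dominant_bd := dominant_id _

theorem baseChange_self (Ω : VarDiagram A V) : Ω.baseChange A = Ω := by
  cases Ω
  simp [baseChange, MvPolynomial.map_id]

end VarDiagram

/-! ### Ultraproducts of difference fields and bounded fibres -/

section Ultraproduct

universe v

/-- The ideal of the families that vanish almost everywhere with respect to an ultrafilter. -/
def ultraIdeal {I : Type*} (U : Ultrafilter I) (K : I → Type*) [∀ i, Field (K i)] :
    Ideal (∀ i, K i) where
  carrier := {f | ∀ᶠ i in U, f i = 0}
  zero_mem' := Filter.Eventually.of_forall fun _ => rfl
  add_mem' {f g} hf hg := by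
    filter_upwards [hf, hg] with i h1 h2
    simp [h1, h2]
  smul_mem' c f hf := by
    filter_upwards [hf] with i h
    simp [h]

theorem mem_ultraIdeal {I : Type*} {U : Ultrafilter I} {K : I → Type*} [∀ i, Field (K i)]
    {f : ∀ i, K i} : f ∈ ultraIdeal U K ↔ ∀ᶠ i in U, f i = 0 := Iff.rfl

instance isMaximal_ultraIdeal {I : Type*} (U : Ultrafilter I) (K : I → Type*)
    [∀ i, Field (K i)] : (ultraIdeal U K).IsMaximal := by
  refine Ideal.isMaximal_iff.2 ⟨fun h => ?_, fun J f hJ hf hfJ => ?_⟩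
  · obtain ⟨i, hi⟩ := (mem_ultraIdeal.1 h).exists
    exact one_ne_zero hi
  · have h1 : (1 - f⁻¹ * f : ∀ i, K i) ∈ ultraIdeal U K := by
      refine mem_ultraIdeal.2 ?_
      filter_upwards [Ultrafilter.eventually_not.2 hf] with i hi
      simp [inv_mul_cancel₀ (show f i ≠ 0 from hi)]
    have h2 := J.add_mem (hJ h1) (J.mul_mem_left f⁻¹ hfJ)
    simpa using h2

/-- The value of a polynomial whose coefficients are mapped by a function `g`, which need not be
a homomorphism. -/
def partialEval {A K ι : Type*} [CommSemiring A] [CommSemiring K] (g : A → K) (y : ι → K)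
    (p : MvPolynomial ι A) : K :=
  ∑ d ∈ p.support, g (p.coeff d) * ∏ i ∈ d.support, y i ^ d i

theorem partialEval_ringHom {A K ι : Type*} [CommSemiring A] [CommSemiring K] (g : A →+* K)
    (y : ι → K) (p : MvPolynomial ι A) : partialEval g y p = MvPolynomial.eval₂ g y p :=
  (MvPolynomial.eval₂_eq _ _ _).symm

/-- `L` is the ultraproduct of the difference fields `(K i, τ i)`, where `A` acts on almost all
`K i` by `g i`; `mk f` is the class of the family `f`. -/
structure IsUltraproduct {A : Type u} [Field A] {σ : A ≃+* A} {I : Type*} (U : Ultrafilter I)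
    {K : I → Type*} [∀ i, Field (K i)] (τ : ∀ i, K i →+* K i) (g : ∀ i, A → K i)
    (L : DiffExt A σ) (mk : (∀ i, K i) →+* L.K) : Prop where
  mk_eq_zero : ∀ f, mk f = 0 ↔ ∀ᶠ i in U, f i = 0
  τ_mk : ∀ f, L.τ (mk f) = mk fun i => τ i (f i)
  algebraMap_eq : ∀ a, algebraMap A L.K a = mk fun i => g i a

/-- The ultraproduct exists when almost everywhere `g i` respects any given operation on given
elements. -/
theorem exists_isUltraproduct {A : Type (max u v)} [Field A] (σ : A ≃+* A) {I : Type (max u v)}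
    (U : Ultrafilter I) {K : I → Type v} [∀ i, Field (K i)] (τ : ∀ i, K i →+* K i)
    (g : ∀ i, A → K i) (hone : ∀ᶠ i in U, g i 1 = 1)
    (hadd : ∀ a b, ∀ᶠ i in U, g i (a + b) = g i a + g i b)
    (hmul : ∀ a b, ∀ᶠ i in U, g i (a * b) = g i a * g i b)
    (hσ : ∀ a, ∀ᶠ i in U, τ i (g i a) = g i (σ a)) :
    ∃ (L : DiffExt.{max u v} A σ) (mk : (∀ i, K i) →+* L.K), IsUltraproduct U τ g L mk := by
  let J := ultraIdeal U K
  let _ : Field ((∀ i, K i) ⧸ J) := Ideal.Quotient.field J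
  let mk := Ideal.Quotient.mk J
  have hmk : ∀ f f' : ∀ i, K i, (∀ᶠ i in U, f i = f' i) → mk f = mk f' := by
    intro f f' h
    refine Ideal.Quotient.eq.2 (mem_ultraIdeal.2 ?_)
    filter_upwards [h] with i hi
    simp [hi]
  let G : A →+* (∀ i, K i) ⧸ J := RingHom.mk'
    ⟨⟨fun a => mk fun i => g i a, (hmk _ 1 hone).trans (map_one mk)⟩,
      fun a b => (hmk _ _ (hmul a b)).trans (map_mul mk _ _)⟩
    fun a b => (hmk _ _ (hadd a b)).trans (map_add mk _ _)
  let _ : Algebra A ((∀ i, K i) ⧸ J) := G.toAlgebra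
  let T : (∀ i, K i) →+* ∀ i, K i := RingHom.pi fun i => (τ i).comp (Pi.evalRingHom K i)
  have hT : J ≤ J.comap T := by
    intro f hf
    refine mem_ultraIdeal.2 ?_
    filter_upwards [mem_ultraIdeal.1 hf] with i hi
    change τ i (f i) = 0
    rw [hi, map_zero]
  let τ' : (∀ i, K i) ⧸ J →+* (∀ i, K i) ⧸ J := Ideal.quotientMap J T hT
  refine ⟨{ K := (∀ i, K i) ⧸ J, τ := τ', comm := fun a => hmk _ _ (hσ a) }, mk, ?_, ?_, ?_⟩
  · exact fun f => Ideal.Quotient.eq_zero_iff_mem.trans mem_ultraIdeal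
  · exact fun f => rfl
  · exact fun a => rfl

variable {A : Type u} [Field A] {σ : A ≃+* A} {I : Type*} {U : Ultrafilter I}
    {K : I → Type*} [∀ i, Field (K i)] {τ : ∀ i, K i →+* K i} {g : ∀ i, A → K i}
    {L : DiffExt A σ} {mk : (∀ i, K i) →+* L.K}

namespace IsUltraproduct

/-- Łoś's theorem for values of polynomials. -/
theorem aeval_mk (hL : IsUltraproduct U τ g L mk) {ι : Type*} (y : ι → ∀ i, K i)
    (p : MvPolynomial ι A) :
    MvPolynomial.aeval (fun j => mk (y j)) p = mk fun i => partialEval (g i) (fun j => y j i) p := by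
  rw [MvPolynomial.aeval_def, MvPolynomial.eval₂_eq]
  have : (fun i => partialEval (g i) (fun j => y j i) p) =
      ∑ d ∈ p.support, (fun i => g i (p.coeff d)) * ∏ j ∈ d.support, y j ^ d j := by
    funext i
    simp [partialEval]
  rw [this, map_sum]
  simp only [map_mul, map_prod, map_pow, ← hL.algebraMap_eq]

theorem jet_mk (hL : IsUltraproduct U τ g L mk) {ι : Type*} (x : ∀ i, ι → K i) :
    jet L.τ (fun c => mk fun i => x i c) = fun m => mk fun i => jet (τ i) (x i) m := by
  funext ⟨c, n⟩
  simp only [jet]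
  induction n with
  | zero => rfl
  | succ n ih => simp only [Function.iterate_succ_apply', ih, hL.τ_mk]

theorem aeval_jet_mk (hL : IsUltraproduct U τ g L mk) {ι : Type*} (x : ∀ i, ι → K i)
    (p : MvPolynomial (ι × ℕ) A) :
    MvPolynomial.aeval (jet L.τ fun c => mk fun i => x i c) p =
      mk fun i => partialEval (g i) (jet (τ i) (x i)) p := by
  rw [hL.jet_mk, hL.aeval_mk]

theorem mk_eq_mk (hL : IsUltraproduct U τ g L mk) {f f' : ∀ i, K i} :
    mk f = mk f' ↔ ∀ᶠ i in U, f i = f' i := by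
  rw [← sub_eq_zero, ← map_sub, hL.mk_eq_zero]
  simp [sub_eq_zero]

end IsUltraproduct

end Ultraproduct

section FibreBound

variable {A : Type u} [Field A] {σ : A ≃+* A}

/-- Algebraicity over `A(a)_σ` is witnessed by a polynomial with difference polynomials in `a` as
coefficients. -/
theorem exists_polynomial_of_isAlgebraic {L : DiffExt A σ} {ι : Type*} {a : ι → L.K} {r : L.K}
    (h : IsAlgebraic (diffAdjoin L a) r) :
    ∃ F : Polynomial (MvPolynomial (ι × ℕ) A),
      F.map (MvPolynomial.aeval (jet L.τ a) : MvPolynomial (ι × ℕ) A →ₐ[A] L.K).toRingHom ≠ 0 ∧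
      F.eval₂ (MvPolynomial.aeval (jet L.τ a) :
        MvPolynomial (ι × ℕ) A →ₐ[A] L.K).toRingHom r = 0 := by
  obtain ⟨f, hf0, hf⟩ := isAlgebraic_algebraAdjoin_iff.2 h
  have hr := Algebra.adjoin_range_eq_range_aeval A (jet L.τ a)
  let ev : MvPolynomial (ι × ℕ) A →ₐ[A] Algebra.adjoin A (Set.range (jet L.τ a)) :=
    (MvPolynomial.aeval (jet L.τ a)).codRestrict _ fun p => hr ▸ ⟨p, rfl⟩
  have hev : (MvPolynomial.aeval (jet L.τ a) : MvPolynomial (ι × ℕ) A →ₐ[A] L.K).toRingHom =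
      (algebraMap (Algebra.adjoin A (Set.range (jet L.τ a))) L.K).comp ev.toRingHom :=
    RingHom.ext fun p => rfl
  have hsurj : Function.Surjective ev.toRingHom := by
    rintro ⟨s, hs⟩
    have hs' := hs
    rw [hr] at hs'
    obtain ⟨p, hp⟩ := hs'
    exact ⟨p, Subtype.ext hp⟩
  obtain ⟨F, rfl⟩ := Polynomial.map_surjective _ hsurj f
  refine ⟨F, fun h0 => hf0 ?_, ?_⟩
  · rw [hev, ← Polynomial.map_map] at h0
    exact (Polynomial.map_eq_zero_iff Subtype.val_injective).1 h0
  · rw [hev, ← Polynomial.eval₂_map]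
    exact hf

/-- By compactness, finitely many polynomials bear witness to the algebraicity of a coordinate. -/
theorem exists_finset_polynomial {ι κ : Type} (f : ι → κ) {eqs : Set (MvPolynomial (κ × ℕ) A)}
    {k : κ}
    (h : ∀ (L : DiffExt A σ) (x : κ → L.K), (∀ p ∈ eqs, MvPolynomial.aeval (jet L.τ x) p = 0) →
      IsAlgebraic (diffAdjoin L (x ∘ f)) (x k)) :
    ∃ T : Finset (Polynomial (MvPolynomial (ι × ℕ) A)), ∀ (L : DiffExt A σ) (x : κ → L.K),
      (∀ p ∈ eqs, MvPolynomial.aeval (jet L.τ x) p = 0) → ∃ F ∈ T,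
        F.map (MvPolynomial.aeval (jet L.τ (x ∘ f)) :
          MvPolynomial (ι × ℕ) A →ₐ[A] L.K).toRingHom ≠ 0 ∧
        F.eval₂ (MvPolynomial.aeval (jet L.τ (x ∘ f)) :
          MvPolynomial (ι × ℕ) A →ₐ[A] L.K).toRingHom (x k) = 0 := by
  classical
  by_contra! hcon
  choose L x hx hbad using hcon
  let U : Ultrafilter (Finset (Polynomial (MvPolynomial (ι × ℕ) A))) :=
    Ultrafilter.of Filter.atTop
  obtain ⟨L', mk, hL⟩ := exists_isUltraproduct.{u, u} σ U (fun T => (L T).τ)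
    (fun T => algebraMap A (L T).K) (.of_forall fun T => map_one _)
    (fun a b => .of_forall fun T => map_add _ _ _) (fun a b => .of_forall fun T => map_mul _ _ _)
    (fun a => .of_forall fun T => (L T).comm a)
  have haeval : ∀ {ι' : Type} (y : ∀ T, ι' → (L T).K) (p : MvPolynomial (ι' × ℕ) A),
      MvPolynomial.aeval (jet L'.τ fun c => mk fun T => y T c) p =
        mk fun T => MvPolynomial.aeval (jet (L T).τ (y T)) p := fun y p => by
    rw [hL.aeval_jet_mk]
    simp only [partialEval_ringHom, MvPolynomial.aeval_def]
  obtain ⟨F, hF0, hF⟩ := exists_polynomial_of_isAlgebraic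
    (h L' (fun c => mk fun T => x T c) fun p hp => by
      rw [haeval, hL.mk_eq_zero]
      exact .of_forall fun T => hx T p hp)
  let Φ : MvPolynomial (ι × ℕ) A →+* ∀ T, (L T).K := RingHom.pi fun T =>
    (MvPolynomial.aeval (jet (L T).τ (x T ∘ f)) :
      MvPolynomial (ι × ℕ) A →ₐ[A] (L T).K).toRingHom
  have hΦ : (MvPolynomial.aeval (jet L'.τ ((fun c => mk fun T => x T c) ∘ f)) :
      MvPolynomial (ι × ℕ) A →ₐ[A] L'.K).toRingHom = mk.comp Φ :=
    RingHom.ext fun p => haeval (fun T => x T ∘ f) p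
  rw [hΦ] at hF0 hF
  rw [← Polynomial.hom_eval₂, hL.mk_eq_zero] at hF
  obtain ⟨n, hn⟩ : ∃ n, (F.map (mk.comp Φ)).coeff n ≠ 0 := by
    by_contra! h0
    exact hF0 (Polynomial.ext (by simpa using h0))
  rw [Polynomial.coeff_map, RingHom.comp_apply, ne_eq, hL.mk_eq_zero,
    ← Ultrafilter.eventually_not] at hn
  have hmem : ∀ᶠ T in (U : Filter (Finset _)), F ∈ T :=
    ((Filter.eventually_ge_atTop ({F} : Finset _)).mono fun T hT =>
      hT (Finset.mem_singleton_self F)).filter_mono (Ultrafilter.of_le _)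
  obtain ⟨T, ⟨hT1, hT2⟩, hT3⟩ := ((hF.and hn).and hmem).exists
  refine hbad T F hT3 (fun h0 => hT2 ?_) ?_
  · have := congrArg (fun G => Polynomial.coeff G n) h0
    rw [Polynomial.coeff_map, Polynomial.coeff_zero] at this
    exact this
  · rw [← hT1]
    exact (Polynomial.hom_eval₂ F Φ (Pi.evalRingHom _ T) (fun T => x T k)).symm

/-- The fibres of a finite projection are uniformly bounded. -/
theorem exists_fibre_bound {ι κ : Type} [Finite κ] (f : ι → κ)
    {eqs : Set (MvPolynomial (κ × ℕ) A)}
    (h : ∀ (L : DiffExt A σ) (x : κ → L.K), (∀ p ∈ eqs, MvPolynomial.aeval (jet L.τ x) p = 0) →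
      ∀ k, IsAlgebraic (diffAdjoin L (x ∘ f)) (x k)) :
    ∃ N : ℕ, ∀ (L : DiffExt A σ) (a : ι → L.K),
      {x : κ → L.K | (∀ p ∈ eqs, MvPolynomial.aeval (jet L.τ x) p = 0) ∧ x ∘ f = a}.encard ≤ N := by
  classical
  have := Fintype.ofFinite κ
  choose T hT using fun k => exists_finset_polynomial f (k := k) fun L x hx => h L x hx k
  refine ⟨∏ k, ∑ F ∈ T k, F.natDegree, fun L a => ?_⟩
  let ev := (MvPolynomial.aeval (jet L.τ a) : MvPolynomial (ι × ℕ) A →ₐ[A] L.K).toRingHom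
  let R : κ → Finset L.K := fun k => (T k).biUnion fun F => (F.map ev).roots.toFinset
  have hsub : {x : κ → L.K | (∀ p ∈ eqs, MvPolynomial.aeval (jet L.τ x) p = 0) ∧ x ∘ f = a} ⊆
      Fintype.piFinset R := by
    rintro x ⟨hx, rfl⟩
    refine Finset.mem_coe.2 (Fintype.mem_piFinset.2 fun k => ?_)
    obtain ⟨F, hF, h0, hroot⟩ := hT k L x hx
    refine Finset.mem_biUnion.2 ⟨F, hF, ?_⟩
    rw [Multiset.mem_toFinset, Polynomial.mem_roots h0, Polynomial.IsRoot, Polynomial.eval_map]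
    exact hroot
  refine (Set.encard_le_encard hsub).trans ?_
  rw [Set.encard_coe_eq_coe_finsetCard, Fintype.card_piFinset]
  norm_cast
  refine Finset.prod_le_prod' fun k _ => Finset.card_biUnion_le.trans
    (Finset.sum_le_sum fun F _ => ?_)
  exact (Multiset.toFinset_card_le _).trans ((Polynomial.card_roots' _).trans
    Polynomial.natDegree_map_le)

end FibreBound

namespace VarDiagram

variable {A : Type u} [Field A] {V : Type w} {Ω : VarDiagram A V} {σ : A ≃+* A}

theorem IsSplittingCover.exists_fibre_bound {v : Finset V} (h : Ω.IsSplittingCover σ v) :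
    ∃ N : ℕ, ∀ (L : DiffExt A σ) (a : Ω.BdCoord v → L.K),
      {x ∈ Ω.pts σ v L | x ∘ Ω.bdEmb v = a}.encard ≤ N := by
  -- The boundary coordinates live in the universe of `V`; their image in `Ω.coord v` generates
  -- the same field and lives in `Type`, as the ultraproduct requires.
  let f : Set.range (Ω.bdEmb v) → Ω.coord v := Subtype.val
  obtain ⟨N, hN⟩ := DiffHyper.exists_fibre_bound (σ := σ) f (eqs := Ω.eqs v) fun L x hx k => by
    have hr : Set.range (jet L.τ (x ∘ f)) = Set.range (jet L.τ (x ∘ Ω.bdEmb v)) := by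
      refine Set.Subset.antisymm ?_ ?_
      · rintro _ ⟨⟨⟨_, j, rfl⟩, n⟩, rfl⟩
        exact ⟨(j, n), rfl⟩
      · rintro _ ⟨⟨j, n⟩, rfl⟩
        exact ⟨(⟨_, j, rfl⟩, n), rfl⟩
    have := h.isAlgebraic (L := L) (x := x) hx (jet_mem_diffAdjoin x ⟨(k, 0), rfl⟩)
    rw [diffAdjoin, ← hr] at this
    exact this
  refine ⟨N, fun L a => ?_⟩
  by_cases ha : ∃ x₀ : Ω.coord v → L.K, x₀ ∘ Ω.bdEmb v = a
  · obtain ⟨x₀, rfl⟩ := ha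
    refine (Set.encard_le_encard ?_).trans (hN L (x₀ ∘ f))
    rintro x ⟨hx, hxa⟩
    refine ⟨hx, ?_⟩
    funext ⟨_, j, rfl⟩
    exact congrFun hxa j
  · have : {x ∈ Ω.pts σ v L | x ∘ Ω.bdEmb v = a} = ∅ :=
      Set.eq_empty_of_forall_notMem fun x hx => ha ⟨x, hx.2⟩
    simp [this]

/-- The degrees of a system are bounded, so `degree` is a bound. -/
theorem IsSystem.degreeLE_degree [Finite V] (hΩ : Ω.IsSystem σ ⊤) :
    Ω.DegreeLE σ (Ω.degree σ) := by
  classical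
  have := Fintype.ofFinite V
  refine Nat.sInf_mem (s := {D | Ω.DegreeLE σ D}) ?_
  have hcov : ∀ v : Finset V, ∃ N : ℕ, 2 ≤ v.card → ∀ (L : DiffExt A σ) (a : Ω.BdCoord v → L.K),
      {x ∈ Ω.pts σ v L | x ∘ Ω.bdEmb v = a}.encard ≤ N := by
    intro v
    by_cases hv : 2 ≤ v.card
    · obtain ⟨N, hN⟩ := (hΩ.splitting v trivial hv).exists_fibre_bound
      exact ⟨N, fun _ => hN⟩
    · exact ⟨0, fun h => absurd h hv⟩
  choose N hN using hcov
  let B : Finset V → ℕ := fun v => Fintype.card (Ω.coord v) + (Ω.eqs v).ncard +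
    ((Ω.eqs_finite v).toFinset.sup fun p => p.vars.sup Prod.snd) +
    ((Ω.eqs_finite v).toFinset.sup fun p => p.totalDegree) + N v
  have hB : ∀ v, B v ≤ ∑ v, B v := fun v =>
    Finset.single_le_sum (fun _ _ => Nat.zero_le _) (Finset.mem_univ v)
  refine ⟨∑ v, B v, ?_, ?_, ?_, ?_, ?_⟩
  · intro v
    refine le_trans ?_ (hB v)
    simp only [B]; omega
  · intro v
    refine le_trans ?_ (hB v)
    simp only [B]; omega
  · intro v p hp m hm
    refine le_trans ?_ (hB v)
    have h1 : m.2 ≤ p.vars.sup Prod.snd := Finset.le_sup (f := Prod.snd) hm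
    have h2 := Finset.le_sup (f := fun p : MvPolynomial (Ω.coord v × ℕ) A => p.vars.sup Prod.snd)
      ((Ω.eqs_finite v).mem_toFinset.2 hp)
    simp only [B]; omega
  · intro v p hp
    refine le_trans ?_ (hB v)
    have h2 := Finset.le_sup (f := fun p : MvPolynomial (Ω.coord v × ℕ) A => p.totalDegree)
      ((Ω.eqs_finite v).mem_toFinset.2 hp)
    simp only [B]; omega
  · intro v hv L a
    refine (hN v hv L a).trans ?_
    have : N v ≤ ∑ v, B v := le_trans (by simp only [B]; omega) (hB v)
    exact_mod_cast this

end VarDiagram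

/-! ### Frobenius specialisations -/

section Sites

/-- A Frobenius specialisation: a homomorphism of difference rings from a subring of `A` to the
algebraic closure of `ZMod p` with the operator `x ↦ x ^ (p ^ n)`. -/
structure Site {A : Type u} [Field A] (σ : A ≃+* A) where
  R : Subring A
  p : ℕ
  [prime : Fact p.Prime]
  n : ℕ
  n_pos : 0 < n
  h : R →+* AlgebraicClosure (ZMod p)
  frob : ∀ r s : R, (s : A) = σ r → h s = h r ^ (p ^ n)

attribute [instance] Site.prime

variable {A : Type u} [Field A] {σ : A ≃+* A}

/-- The extension by zero of a ring homomorphism defined on a subring. -/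
def extendZero {R : Subring A} {k : Type*} [Field k] (h : R →+* k) (a : A) : k :=
  open scoped Classical in if ha : a ∈ R then h ⟨a, ha⟩ else 0

namespace Site

/-- The field in which a specialisation takes its values. -/
abbrev K (s : Site σ) : Type := AlgebraicClosure (ZMod s.p)

/-- The prime power `q` such that the operator of the specialisation is `x ↦ x ^ q`. -/
def q (s : Site σ) : ℕ := s.p ^ s.n

/-- The operator `x ↦ x ^ q`. -/
def τ (s : Site σ) : s.K →+* s.K := iterateFrobenius s.K s.p s.n

theorem two_le_q (s : Site σ) : 2 ≤ s.q :=
  s.prime.out.two_le.trans (Nat.le_self_pow s.n_pos.ne' _)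

end Site

theorem extendZero_of_mem {R : Subring A} {k : Type*} [Field k] (h : R →+* k) {a : A}
    (ha : a ∈ R) : extendZero h a = h ⟨a, ha⟩ := by simp [extendZero, ha]

variable (σ) in
/-- The filter of those properties of specialisations that hold for all sufficiently large `q`
and all subrings that contain the difference subring generated by a certain finite set. -/
def siteFilter : Filter (Site σ) where
  sets := {P | ∃ (t : Finset A) (q₀ : ℕ), ∀ s : Site σ,
    (∀ a ∈ t, ∀ k : ℕ, σ^[k] a ∈ s.R) → q₀ ≤ s.q → s ∈ P}
  univ_sets := ⟨∅, 0, fun _ _ _ => trivial⟩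
  sets_of_superset := fun ⟨t, q₀, h⟩ hPQ => ⟨t, q₀, fun s hs hq => hPQ (h s hs hq)⟩
  inter_sets := fun ⟨t, q₀, h⟩ ⟨t', q₀', h'⟩ => by
    classical
    refine ⟨t ∪ t', max q₀ q₀', fun s hs hq => ⟨h s (fun a ha => hs a ?_) ?_,
      h' s (fun a ha => hs a ?_) ?_⟩⟩
    · exact Finset.mem_union_left _ ha
    · exact (le_max_left _ _).trans hq
    · exact Finset.mem_union_right _ ha
    · exact (le_max_right _ _).trans hq

theorem eventually_siteFilter {P : Site σ → Prop} : (∀ᶠ s in siteFilter σ, P s) ↔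
    ∃ (t : Finset A) (q₀ : ℕ), ∀ s : Site σ,
      (∀ a ∈ t, ∀ k : ℕ, σ^[k] a ∈ s.R) → q₀ ≤ s.q → P s := Iff.rfl

theorem eventually_mem (a : A) : ∀ᶠ s in siteFilter σ, a ∈ s.R :=
  ⟨{a}, 0, fun _ hs _ => hs a (Finset.mem_singleton_self a) 0⟩

theorem eventually_le_q (q₀ : ℕ) : ∀ᶠ s in siteFilter σ, q₀ ≤ s.q :=
  ⟨∅, q₀, fun _ _ hq => hq⟩

theorem almostAll_of_eventually {Def : Subring A → Prop}
    {Q : ∀ (R : Subring A) (p : ℕ) [Fact p.Prime] (_ : ℕ),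
      (R →+* AlgebraicClosure (ZMod p)) → Prop}
    (t₀ : Finset A) (hDef : ∀ R : Subring A, (∀ a ∈ t₀, a ∈ R) → Def R)
    (h : ∀ᶠ s in siteFilter σ, Q s.R s.p s.q s.h) : AlmostAll σ Def Q := by
  classical
  obtain ⟨t, q₀, h⟩ := eventually_siteFilter.1 h
  have hmem : ∀ a ∈ t ∪ t₀, ∀ k : ℕ,
      σ^[k] a ∈ Subring.closure {y | ∃ a ∈ t ∪ t₀, ∃ n : ℕ, y = σ^[n] a} :=
    fun a ha k => Subring.subset_closure ⟨a, ha, k, rfl⟩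
  refine ⟨_, ⟨t ∪ t₀, rfl⟩, hDef _ fun a ha => hmem a (Finset.mem_union_right _ ha) 0, q₀, ?_⟩
  intro p _ n hn hq f hf
  exact h ⟨_, p, n, hn, f, hf⟩ (fun a ha => hmem a (Finset.mem_union_left _ ha)) hq

theorem eventually_of_almostAll {Def : Subring A → Prop}
    {Q : ∀ (R : Subring A) (p : ℕ) [Fact p.Prime] (_ : ℕ),
      (R →+* AlgebraicClosure (ZMod p)) → Prop} (h : AlmostAll σ Def Q) :
    ∃ R : Subring A, Def R ∧ ∀ᶠ s in siteFilter σ, ∃ hR : R ≤ s.R,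
      Q R s.p s.q (s.h.comp (Subring.inclusion hR)) := by
  obtain ⟨_, ⟨t, rfl⟩, hDef, q₀, h⟩ := h
  refine ⟨_, hDef, t, q₀, fun s hs hq => ?_⟩
  have hR : Subring.closure {y | ∃ a ∈ t, ∃ n : ℕ, y = σ^[n] a} ≤ s.R := by
    refine (Subring.closure_le).2 ?_
    rintro _ ⟨a, ha, k, rfl⟩
    exact hs a ha k
  exact ⟨hR, h s.p s.n s.n_pos hq _ fun r r' hr => s.frob _ _ hr⟩

/-- An ultraproduct of specialisations along the filter `siteFilter` is an extension of all of `A`,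
although each of them is defined on a subring only. -/
theorem exists_isUltraproduct_site {I : Type u} {φ : I → Site σ} {U : Ultrafilter I}
    (hU : Filter.Tendsto φ U (siteFilter σ)) :
    ∃ (L : DiffExt A σ) (mk : (∀ i, (φ i).K) →+* L.K),
      IsUltraproduct U (fun i => (φ i).τ) (fun i => extendZero (φ i).h) L mk := by
  refine exists_isUltraproduct.{u, 0} σ U _ _ ?_ ?_ ?_ ?_
  · refine .of_forall fun i => ?_
    rw [extendZero_of_mem _ (one_mem _)]
    exact map_one _
  · intro a b
    filter_upwards [hU (eventually_mem a), hU (eventually_mem b)] with i ha hb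
    rw [extendZero_of_mem _ ha, extendZero_of_mem _ hb, extendZero_of_mem _ (add_mem ha hb)]
    exact map_add _ (⟨a, ha⟩ : (φ i).R) ⟨b, hb⟩
  · intro a b
    filter_upwards [hU (eventually_mem a), hU (eventually_mem b)] with i ha hb
    rw [extendZero_of_mem _ ha, extendZero_of_mem _ hb, extendZero_of_mem _ (mul_mem ha hb)]
    exact map_mul _ (⟨a, ha⟩ : (φ i).R) ⟨b, hb⟩
  · intro a
    filter_upwards [hU (eventually_mem a), hU (eventually_mem (σ a))] with i ha hb
    rw [extendZero_of_mem _ ha, extendZero_of_mem _ hb]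
    exact ((φ i).frob ⟨a, ha⟩ ⟨σ a, hb⟩ rfl).symm

/-- A nonzero element specialises to a nonzero element as soon as its inverse is defined. -/
theorem eventually_extendZero_ne_zero {a : A} (ha : a ≠ 0) :
    ∀ᶠ s in siteFilter σ, extendZero s.h a ≠ 0 := by
  filter_upwards [eventually_mem (σ := σ) a, eventually_mem a⁻¹] with s h1 h2 h0
  rw [extendZero_of_mem _ h1] at h0
  have h3 : (⟨a, h1⟩ : s.R) * ⟨a⁻¹, h2⟩ = 1 := Subtype.ext (mul_inv_cancel₀ ha)
  have h4 := congrArg s.h h3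
  rw [map_mul, h0, zero_mul, map_one] at h4
  exact zero_ne_one h4

end Sites

section Roots

open Polynomial in
/-- A nonzero polynomial vanishes at `(r, r ^ q, r ^ (q ^ 2), …)` for finitely many `r` only, if
`q` exceeds its degree: the exponents of the monomials differ, having different digits in
base `q`. -/
theorem finite_setOf_partialEval_pow_eq_zero {A k : Type*} [Field A] [Field k] {d q : ℕ}
    {f : MvPolynomial (Fin d) A} (hq : f.totalDegree < q) (hq1 : 1 < q) {g : A → k}
    {m₀ : Fin d →₀ ℕ} (hm₀ : m₀ ∈ f.support) (hg : g (f.coeff m₀) ≠ 0) :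
    {r : k | partialEval g (fun n : Fin d => r ^ q ^ (n : ℕ)) f = 0}.Finite := by
  classical
  -- the exponent of the univariate monomial into which the monomial `m` turns
  let e : (Fin d →₀ ℕ) → ℕ := fun m => ∑ n : Fin d, q ^ (n : ℕ) * m n
  let P : k[X] := ∑ m ∈ f.support, monomial (e m) (g (f.coeff m))
  have hlt : ∀ m ∈ f.support, ∀ n, m n < q := fun m hm n =>
    ((MvPolynomial.le_degreeOf_of_mem_support n hm).trans
      (MvPolynomial.degreeOf_le_totalDegree f n)).trans_lt hq
  have hinj : ∀ m ∈ f.support, ∀ m' ∈ f.support, e m = e m' → m = m' := by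
    intro m hm m' hm' h
    refine Finsupp.ext (congrFun (List.ofFn_injective ?_))
    have hdig : ∀ m ∈ f.support, ∀ l ∈ List.ofFn ⇑m, l < q := by
      intro m hm l hl
      obtain ⟨n, rfl⟩ := (List.mem_ofFn' _ _).1 hl
      exact hlt m hm n
    refine Nat.ofDigits_inj_of_len_eq hq1 (by simp) (hdig m hm) (hdig m' hm') ?_
    simpa only [e, Nat.ofDigits_eq_sum_mapIdx, List.mapIdx_eq_ofFn, List.get_ofFn,
      List.length_ofFn, Fin.val_cast, mul_comm, List.sum_ofFn] using! h
  have hP : P ≠ 0 := by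
    intro h0
    have h1 : P.coeff (e m₀) = g (f.coeff m₀) := by
      simp only [P, finsetSum_coeff, coeff_monomial]
      rw [Finset.sum_eq_single m₀]
      · simp
      · intro m hm hne
        exact if_neg fun h => hne (hinj m hm m₀ hm₀ h)
      · exact fun h => absurd hm₀ h
    rw [h0, coeff_zero] at h1
    exact hg h1.symm
  refine (P.roots.toFinset.finite_toSet).subset fun r hr => ?_
  rw [Finset.mem_coe, Multiset.mem_toFinset, mem_roots hP, IsRoot]
  refine Eq.trans ?_ hr
  simp only [P, eval_finsetSum, eval_monomial, partialEval]
  refine Finset.sum_congr rfl fun m _ => ?_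
  congr 1
  rw [← Finset.prod_pow_eq_pow_sum]
  simp only [pow_mul]
  exact (Finset.prod_subset (Finset.subset_univ _) fun n _ hn => by
    rw [Finsupp.notMem_support_iff.1 hn, pow_zero]).symm

theorem exists_forall_eventually_of_eventually_exists {α : Type*} {β : α → Type*}
    [∀ a, Nonempty (β a)] {l : Filter α} {r : ∀ a, β a → Prop} (h : ∀ᶠ a in l, ∃ b, r a b) :
    ∃ f : ∀ a, β a, ∀ᶠ a in l, r a (f a) :=
  ⟨fun a => Classical.epsilon (r a), h.mono fun _ ha => Classical.epsilon_spec ha⟩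

/-- Compactness of the space of ultrafilters that refine `l`. -/
theorem exists_finset_of_ultrafilter {α ι : Type*} {l : Filter α} {B : ι → Set α}
    (h : ∀ U : Ultrafilter α, (U : Filter α) ≤ l → ∃ i, B i ∈ U) :
    ∃ F : Finset ι, ∀ᶠ a in l, ∃ i ∈ F, a ∈ B i := by
  classical
  by_contra! hcon
  have hne : (⨅ F : Finset ι, l ⊓ Filter.principal {a | ∀ i ∈ F, a ∉ B i}).NeBot := by
    refine Filter.iInf_neBot_of_directed' (fun F F' => ⟨F ∪ F', ?_, ?_⟩) fun F => ?_
    · exact inf_le_inf_left _ (Filter.principal_mono.2 fun a ha i hi =>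
        ha i (Finset.mem_union_left _ hi))
    · exact inf_le_inf_left _ (Filter.principal_mono.2 fun a ha i hi =>
        ha i (Finset.mem_union_right _ hi))
    · exact Filter.frequently_mem_iff_neBot.1 ((hcon F).mono fun a ha => ha)
  obtain ⟨U, hU⟩ := Ultrafilter.exists_le (⨅ F : Finset ι, l ⊓ Filter.principal {a | ∀ i ∈ F, a ∉ B i})
  obtain ⟨i, hi⟩ := h U (hU.trans ((iInf_le _ ∅).trans inf_le_left))
  have h2 : {a | ∀ j ∈ ({i} : Finset ι), a ∉ B j} ∈ U :=
    hU.trans ((iInf_le _ {i}).trans inf_le_right) (Filter.mem_principal_self _)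
  obtain ⟨a, h3, h4⟩ := U.nonempty_of_mem (Filter.inter_mem hi h2)
  exact h4 i (Finset.mem_singleton_self i) h3

end Roots

namespace VarDiagram

variable {A : Type u} [Field A] {V : Type w} {Ω : VarDiagram A V} {σ : A ≃+* A}

theorem exists_finset_definedOver [Finite V] (Ω : VarDiagram A V) :
    ∃ t : Finset A, ∀ R : Subring A, (∀ a ∈ t, a ∈ R) → Ω.DefinedOver R := by
  classical
  have := Fintype.ofFinite V
  refine ⟨Finset.univ.biUnion fun v => (Ω.eqs_finite v).toFinset.biUnion fun p =>
    p.support.image p.coeff, fun R hR v p hp m => ?_⟩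
  by_cases hm : m ∈ p.support
  · refine hR _ (Finset.mem_biUnion.2 ⟨v, Finset.mem_univ v, Finset.mem_biUnion.2 ⟨p,
      (Ω.eqs_finite v).mem_toFinset.2 hp, Finset.mem_image_of_mem _ hm⟩⟩)
  · rw [MvPolynomial.notMem_support_iff.1 hm]
    exact zero_mem R

theorem eventually_definedOver [Finite V] (Ω : VarDiagram A V) :
    ∀ᶠ s in siteFilter σ, Ω.DefinedOver s.R := by
  obtain ⟨t, ht⟩ := Ω.exists_finset_definedOver
  have : ∀ᶠ s in siteFilter σ, ∀ a ∈ t, a ∈ s.R :=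
    (Filter.eventually_all_finset t).2 fun a _ => eventually_mem a
  exact this.mono fun s => ht s.R

theorem mem_specPts_iff {R : Subring A} (hR : Ω.DefinedOver R) {k : Type*} [Field k]
    (h : R →+* k) (q : ℕ) {v : Finset V} {x : Ω.coord v → k} :
    x ∈ Ω.specPts h q v ↔
      ∀ p ∈ Ω.eqs v, partialEval (extendZero h) (jet (fun y => y ^ q) x) p = 0 := by
  have key : ∀ p : MvPolynomial (Ω.coord v × ℕ) R,
      partialEval (extendZero h) (jet (fun y => y ^ q) x) (MvPolynomial.map R.subtype p) =
        MvPolynomial.eval₂ h (jet (fun y => y ^ q) x) p := by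
    intro p
    rw [partialEval, MvPolynomial.eval₂_eq,
      MvPolynomial.support_map_of_injective _ R.subtype_injective]
    refine Finset.sum_congr rfl fun m _ => ?_
    rw [MvPolynomial.coeff_map]
    congr 1
    exact extendZero_of_mem h (p.coeff m).2
  constructor
  · intro hx p hp
    obtain ⟨p', rfl⟩ : p ∈ Set.range (MvPolynomial.map (σ := Ω.coord v × ℕ) R.subtype) := by
      rw [MvPolynomial.mem_range_map_iff_coeffs_subset]
      intro c hc
      obtain ⟨m, -, rfl⟩ := MvPolynomial.mem_coeffs_iff.1 hc
      exact ⟨⟨_, hR v p hp m⟩, rfl⟩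
    rw [key]
    exact hx p' hp
  · intro hx p hp
    rw [← key]
    exact hx _ hp

/-- The specialisation does not depend on the ring over which the equations are considered. -/
theorem specPts_inclusion {R R' : Subring A} (hR : Ω.DefinedOver R) (hRR' : R ≤ R') {k : Type*}
    [Field k] (h : R' →+* k) (q : ℕ) :
    Ω.specPts (h.comp (Subring.inclusion hRR')) q = Ω.specPts h q := by
  funext v
  ext x
  rw [mem_specPts_iff hR, mem_specPts_iff fun v p hp m => hRR' (hR v p hp m)]
  refine forall₂_congr fun p hp => ?_
  rw [partialEval, partialEval]
  refine Eq.congr_left (Finset.sum_congr rfl fun m _ => ?_)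
  rw [extendZero_of_mem _ (hR v p hp m), extendZero_of_mem _ (hRR' (hR v p hp m))]
  rfl

/-- The points of the specialisation of `Ω(v)` at a site. -/
def sitePts (Ω : VarDiagram A V) (s : Site σ) (v : Finset V) : Set (Ω.coord v → s.K) :=
  Ω.specPts s.h s.q v

/-- Łoś's theorem for the equations of `Ω(v)`. -/
theorem mk_mem_pts_iff [Finite V] {I : Type u} {φ : I → Site σ} {U : Ultrafilter I}
    (hU : Filter.Tendsto φ U (siteFilter σ)) {L : DiffExt A σ}
    {mk : (∀ i, (φ i).K) →+* L.K}
    (hL : IsUltraproduct U (fun i => (φ i).τ) (fun i => extendZero (φ i).h) L mk)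
    {v : Finset V} (x : ∀ i, Ω.coord v → (φ i).K) :
    (fun c => mk fun i => x i c) ∈ Ω.pts σ v L ↔ ∀ᶠ i in U, x i ∈ Ω.sitePts (φ i) v := by
  have h1 : (∀ᶠ i in U, x i ∈ Ω.sitePts (φ i) v) ↔ ∀ᶠ i in U, ∀ p ∈ Ω.eqs v,
      partialEval (extendZero (φ i).h) (jet (φ i).τ (x i)) p = 0 := by
    refine Filter.eventually_congr ?_
    filter_upwards [hU Ω.eventually_definedOver] with i hi
    exact mem_specPts_iff hi (φ i).h (φ i).q
  rw [h1, Filter.eventually_all_finite (Ω.eqs_finite v)]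
  refine forall₂_congr fun p _ => ?_
  rw [hL.aeval_jet_mk, hL.mk_eq_zero]

/-- Almost all specialisations of a variety of finite total dimension are finite: by compactness
finitely many nontrivial equations of bounded order cover the values of each coordinate. -/
theorem eventually_finite_sitePts [Finite V] (hΩ : Ω.IsSystem σ ⊤) (v : Finset V) :
    ∀ᶠ s in siteFilter σ, (Ω.sitePts s v).Finite := by
  classical
  obtain ⟨d, hd⟩ := ENat.ne_top_iff_exists.1 (hΩ.dim_lt_top v trivial).ne
  have key : ∀ c : Ω.coord v, ∀ᶠ s in siteFilter σ,
      ((fun x => x c) '' Ω.sitePts s v).Finite := by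
    intro c
    obtain ⟨F, hF⟩ := exists_finset_of_ultrafilter
      (l := (siteFilter σ).comap (Sigma.fst : (Σ s : Site σ, Ω.sitePts s v) → Site σ))
      (B := fun f : {f : MvPolynomial (Fin (d + 1)) A // f ≠ 0} => {a |
        partialEval (extendZero a.1.h) (fun n : Fin (d + 1) => a.2.1 c ^ a.1.q ^ (n : ℕ))
          f.1 = 0}) (by
        intro U hU
        have hU' := Filter.tendsto_iff_comap.2 hU
        obtain ⟨L, mk, hL⟩ := exists_isUltraproduct_site hU'
        have hmem := (mk_mem_pts_iff hU' hL (fun a => a.2.1)).2 (.of_forall fun a => a.2.2)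
        obtain ⟨f, hf0, hf⟩ := exists_aeval_eq_zero_of_trdegAt_le
          ((trdegAt_le_totalDim _ hmem).trans hd.ge) c
        refine ⟨⟨f, hf0⟩, ?_⟩
        have hjet : (fun n : Fin (d + 1) => L.τ^[n] (mk fun a => a.2.1 c)) =
            fun n : Fin (d + 1) => mk fun a => a.2.1 c ^ a.1.q ^ (n : ℕ) := by
          funext n
          refine (congrFun (hL.jet_mk fun a => a.2.1) (c, (n : ℕ))).trans ?_
          congr 1
          funext a
          exact congrFun (pow_iterate a.1.q n) (a.2.1 c)
        rw [hjet, hL.aeval_mk, hL.mk_eq_zero] at hf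
        exact hf)
    rw [Filter.eventually_comap] at hF
    have hfin : ∀ f ∈ F, ∀ᶠ s in siteFilter σ, {r : s.K | partialEval (extendZero s.h)
        (fun n : Fin (d + 1) => r ^ s.q ^ (n : ℕ)) f.1 = 0}.Finite := by
      intro f _
      obtain ⟨m, hm⟩ := MvPolynomial.ne_zero_iff.1 f.2
      filter_upwards [eventually_le_q (f.1.totalDegree + 1), eventually_extendZero_ne_zero hm]
        with s hs hg
      exact finite_setOf_partialEval_pow_eq_zero hs s.two_le_q
        (MvPolynomial.mem_support_iff.2 hm) hg
    filter_upwards [hF, (Filter.eventually_all_finset F).2 hfin] with s hs hs'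
    refine (Set.Finite.biUnion F.finite_toSet fun f hf => hs' f hf).subset ?_
    rintro _ ⟨x, hx, rfl⟩
    obtain ⟨f, hf, h⟩ := hs ⟨s, x, hx⟩ rfl
    exact Set.mem_biUnion hf h
  filter_upwards [Filter.eventually_all.2 key] with s hs
  exact (Set.Finite.pi' hs).subset fun x hx c => ⟨x, hx, rfl⟩

theorem eventually_projects [Finite V] (hΩ : Ω.IsSystem σ ⊤) {v v' : Finset V} (h : v ⊆ v') :
    ∀ᶠ s in siteFilter σ, ∀ x ∈ Ω.sitePts s v', x ∘ Ω.emb h ∈ Ω.sitePts s v := by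
  refine Filter.mem_iff_ultrafilter.2 fun U hU => ?_
  by_contra hcon
  have hcon' : ∀ᶠ s in (U : Filter (Site σ)), ∃ x : Ω.coord v' → s.K,
      x ∈ Ω.sitePts s v' ∧ x ∘ Ω.emb h ∉ Ω.sitePts s v := by
    filter_upwards [Ultrafilter.eventually_not.2 hcon] with s hs
    by_contra! h'
    exact hs h'
  obtain ⟨x, hx⟩ := exists_forall_eventually_of_eventually_exists hcon'
  have hU' : Filter.Tendsto (fun s : Site σ => s) U (siteFilter σ) := hU
  obtain ⟨L, mk, hL⟩ := exists_isUltraproduct_site hU'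
  have h1 := (mk_mem_pts_iff hU' hL x).2 (hx.mono fun s hs => hs.1)
  have h2 := (mk_mem_pts_iff hU' hL fun s => x s ∘ Ω.emb h).1
    (hΩ.projects h trivial L (fun c => mk fun s => x s c) h1)
  obtain ⟨s, hs, hs'⟩ := (hx.and h2).exists
  exact hs.2 hs'

theorem eventually_encard_fibre_le [Finite V] {v : Finset V} {N : ℕ}
    (hN : ∀ (L : DiffExt A σ) (a : Ω.BdCoord v → L.K),
      {x ∈ Ω.pts σ v L | x ∘ Ω.bdEmb v = a}.encard ≤ N) :
    ∀ᶠ s in siteFilter σ, ∀ a : Ω.BdCoord v → s.K,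
      {x ∈ Ω.sitePts s v | x ∘ Ω.bdEmb v = a}.encard ≤ N := by
  refine Filter.mem_iff_ultrafilter.2 fun U hU => ?_
  by_contra hcon
  have hcon' : ∀ᶠ s in (U : Filter (Site σ)), ∃ x : Fin (N + 1) → Ω.coord v → s.K, Function.Injective x ∧
      (∀ j, x j ∈ Ω.sitePts s v) ∧ ∀ j, x j ∘ Ω.bdEmb v = x 0 ∘ Ω.bdEmb v := by
    filter_upwards [Ultrafilter.eventually_not.2 hcon] with s hs
    obtain ⟨a, ha⟩ := not_forall.1 hs
    have ha' : ((N + 1 : ℕ) : ℕ∞) ≤ {x ∈ Ω.sitePts s v | x ∘ Ω.bdEmb v = a}.encard := by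
      push_cast
      exact Order.add_one_le_of_lt (not_le.1 ha)
    obtain ⟨t, ht, htc⟩ := Set.exists_subset_encard_eq ha'
    have htf : t.Finite := Set.finite_of_encard_eq_coe htc
    have := htf.fintype
    have hc : Fintype.card t = N + 1 := by
      rw [← Set.coe_fintypeCard] at htc
      exact_mod_cast htc
    let e := (Fintype.equivFinOfCardEq hc).symm
    refine ⟨fun j => (e j).1, Subtype.val_injective.comp e.injective,
      fun j => (ht (e j).2).1, fun j => (ht (e j).2).2.trans (ht (e 0).2).2.symm⟩
  obtain ⟨x, hx⟩ := exists_forall_eventually_of_eventually_exists hcon'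
  have hU' : Filter.Tendsto (fun s : Site σ => s) U (siteFilter σ) := hU
  obtain ⟨L, mk, hL⟩ := exists_isUltraproduct_site hU'
  let y : Fin (N + 1) → Ω.coord v → L.K := fun j c => mk fun s => x s j c
  have hy : Function.Injective y := by
    intro j j' hjj'
    have h1 : ∀ c, ∀ᶠ s in (U : Filter (Site σ)), x s j c = x s j' c := fun c =>
      hL.mk_eq_mk.1 (congrFun hjj' c)
    obtain ⟨s, h2, h3⟩ := ((Filter.eventually_all.2 h1).and hx).exists
    exact h3.1 (funext h2)
  have hsub : Set.range y ⊆ {x ∈ Ω.pts σ v L | x ∘ Ω.bdEmb v = y 0 ∘ Ω.bdEmb v} := by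
    rintro _ ⟨j, rfl⟩
    refine ⟨(mk_mem_pts_iff hU' hL fun s => x s j).2 (hx.mono fun s hs => hs.2.1 j), ?_⟩
    funext b
    exact hL.mk_eq_mk.2 (hx.mono fun s hs => congrFun (hs.2.2 j) b)
  have h4 := (Set.encard_le_encard hsub).trans (hN L _)
  rw [← Set.image_univ, hy.encard_image, Set.encard_univ, ENat.card_eq_coe_fintype_card,
    Fintype.card_fin] at h4
  have : N + 1 ≤ N := by exact_mod_cast h4
  omega

end VarDiagram

/-! ### Edge-uniformity and quasirandomness -/

namespace VarDiagram

variable {A : Type u} [Field A] {V : Type w} {Ω : VarDiagram A V} {σ : A ≃+* A}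

theorem eventually_phi_subset [Finite V] (hΩ : Ω.IsSystem σ ⊤) :
    ∀ᶠ s in siteFilter σ, ∀ u, Ω.phi (Ω.sitePts s) u ⊆ Ω.fibreProd (Ω.sitePts s) u := by
  have h : ∀ᶠ s in siteFilter σ, ∀ (p : Finset V × Finset V) (h : p.1 ⊆ p.2),
      ∀ x ∈ Ω.sitePts s p.2, x ∘ Ω.emb h ∈ Ω.sitePts s p.1 :=
    Filter.eventually_all.2 fun p => Filter.eventually_all.2 fun h => eventually_projects hΩ h
  filter_upwards [h] with s hs u
  rintro _ ⟨x, hx, rfl⟩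
  refine ⟨fun v hv => hs (v, u) hv.subset x hx, fun v v' h hv' => ?_⟩
  funext i
  exact congrArg x (hΩ.emb_trans h hv'.subset trivial i).symm

/-- Edge-uniformity, applied to the system as a refinement of itself, bounds the correlation
of `f_u` with every chain. -/
theorem eventually_abs_finsum_balanced_le [Finite V] [PerfectField A] (hΩ : Ω.IsSystem σ ⊤)
    {ε : Finset V → ℕ → ℝ≥0} {C : ℝ} (h : EtaleEdgeUniformWith σ Ω ε C) {u : Finset V}
    (hu : 2 ≤ u.card) :
    ∀ᶠ s in siteFilter σ, ∀ W, Ω.IsChain (Ω.sitePts s) W u →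
      |∑ᶠ x ∈ Ω.fibreProd W u, Ω.balanced (Ω.sitePts s) u x| ≤
        (Ω.fibreProd (Ω.sitePts s) u).ncard * (max C 0 * ε u s.q) := by
  -- The extension `A` of `A` is generated by the empty set.
  have htop : IntermediateField.adjoin A
      {y : A | ∃ a ∈ (∅ : Finset A), ∃ n : ℤ, y = (σ ^ n : RingAut A) a} = ⊤ :=
    eq_top_iff.2 fun a _ => IntermediateField.algebraMap_mem _ a
  have hb : (Ω.baseChange A).IsSystem σ ⊤ := by
    rw [baseChange_self]
    exact hΩ
  have key : ∀ᶠ s in siteFilter σ, ∀ W, (Ω.baseChange A).IsChain ((Ω.baseChange A).sitePts s) W u →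
      |∑ᶠ x ∈ (Ω.baseChange A).fibreProd W u,
        (Ω.baseChange A).balanced ((Ω.baseChange A).sitePts s) u x| ≤
        ((Ω.baseChange A).fibreProd ((Ω.baseChange A).sitePts s) u).ncard *
          (max C 0 * ε u s.q) := by
    obtain ⟨R, ⟨hR, -⟩, h2⟩ := eventually_of_almostAll
      (h u hu A σ (fun _ => rfl) ⟨∅, htop⟩ (Ω.baseChange A) (fun _ i => i)
        (hb.isBdRefinement_self hu))
    filter_upwards [h2, eventually_phi_subset hb,
      Filter.eventually_all.2 fun v => eventually_finite_sitePts hb v] with s hs hφ hfin W hW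
    obtain ⟨hRs, hs⟩ := hs
    rw [specPts_inclusion hR hRs] at hs
    refine abs_finsum_balanced_le (finite_fibreProd hfin u) (hφ u) (fibreProd_mono hW.1)
      (mul_nonneg (le_max_right _ _) (ε u s.q).2) fun hne => ?_
    have hid : (fun a : (Ω.baseChange A).BdCoord u → s.K =>
        a ∘ bdMap (Ω := Ω.baseChange A) (Ω' := Ω.baseChange A)
          (fun v (i : Ω.coord v) => i) u) ''
          (Ω.baseChange A).fibreProd W u = (Ω.baseChange A).fibreProd W u :=
      Set.image_id _
    have hs' := hs W hW hne
    rw [hid] at hs'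
    exact hs'.trans (mul_le_mul_of_nonneg_right (le_max_left _ _) (ε u s.q).2)
  rw [baseChange_self] at key
  exact key

end VarDiagram

end DiffHyper

theorem proposition5p2p3 (V : Type w) [Fintype V] [DecidableEq V] :
    ∃ C' : ℕ → ℝ → ℝ,
      ∀ (A : Type u) [Field A] [PerfectField A] (σ : A ≃+* A) (Ω : DiffHyper.VarDiagram A V),
        Ω.IsSystem σ ⊤ →
        ∀ (ε : Finset V → ℕ → ℝ≥0) (C : ℝ),
          DiffHyper.EtaleEdgeUniformWith σ Ω ε C →
          DiffHyper.QuasirandomWith σ Ω ε (C' (Ω.degree σ) C) := by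
  open DiffHyper DiffHyper.VarDiagram in
  refine ⟨fun D C => (∑ u : Finset V, cellCount u D : ℕ) * max C 0, ?_⟩
  intro A _ _ σ Ω hΩ ε C hε
  obtain ⟨t, ht⟩ := Ω.exists_finset_definedOver
  have hcov := hΩ.degreeLE_degree.cover
  refine almostAll_of_eventually t ht ?_
  filter_upwards [eventually_phi_subset hΩ,
    Filter.eventually_all.2 fun v => eventually_finite_sitePts hΩ v,
    Filter.eventually_all.2 fun u : Finset V => Filter.eventually_all.2 fun hu : 2 ≤ u.card =>
      eventually_abs_finsum_balanced_le hΩ hε hu,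
    Filter.eventually_all.2 fun v : Finset V => Filter.eventually_all.2 fun hv : 2 ≤ v.card =>
      eventually_encard_fibre_le (hcov v hv)] with s hφ hfin hunif hfib S u hu
  refine ⟨hfin u, finite_fibreProd hfin u, finite_doubling hfin u, ?_⟩
  have hne : u.Nonempty := Finset.card_pos.1 (by omega)
  refine (abs_sum_doubling_le hfib hne hfin (hφ u) (hunif u hu)).trans ?_
  have hle : cellCount u (Ω.degree σ) ≤ ∑ u : Finset V, cellCount u (Ω.degree σ) :=
    Finset.single_le_sum (f := fun u => cellCount u (Ω.degree σ))
      (fun _ _ => Nat.zero_le _) (Finset.mem_univ u)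
  calc _ = (cellCount u (Ω.degree σ) : ℝ) * (max C 0 * ε u s.q *
        ((Ω.fibreProd (Ω.sitePts s) u).ncard : ℝ) ^ 2) := by push_cast; ring
    _ ≤ ((∑ u : Finset V, cellCount u (Ω.degree σ) : ℕ) : ℝ) * (max C 0 * ε u s.q *
        ((Ω.fibreProd (Ω.sitePts s) u).ncard : ℝ) ^ 2) := by
        have : (0 : ℝ) ≤ max C 0 := le_max_right _ _
        gcongr
    _ = _ := by rw [show Ω.sitePts s = S from rfl]; ring
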